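/- **Setting.** Let $d\ge 1$, $q\ge 1$, let $\|\cdot\|$ be any norm on $\mathbb R^d$, $r>0$, and let $\mathcal P_r$ be the set of Borel probability measures carried by the ball $B_r=\{x:\|x\|\le r\}$. Let $W_q$ be the $q$-Wasserstein distance for $\|\cdot\|$, and $\mathrm M(X)=\frac1n\sum_{i=1}^n\delta_{X_i}$ the empirical measure of a sequence $X=[X_1,\dots,X_n]$ of tokens in $\mathbb R^d$. A transformer $\tau=\mathcal L_1\circ\dots\circ\mathcal L_l$ is a composition of layers; its mean-field generalization $T$ is the composition of the maps $\mu\mapsto(\Delta_\mu)_\sharp\,\mu$ with $$\Delta_\mu(x)=\mathrm{MLP}(\Gamma_\mu(x)+x),\qquad \mathrm{MLP}(x)=W_2\,\mathrm{ReLU}(W_1x+b_1)+b_2+x,$$ $$\Gamma_\mu(x)=\sum_{i=1}^h\frac{\int W_o^iW_v^iy\;e^{(W_k^iy)^\top W_q^ix}\,d\mu(y)}{\int e^{(W_k^iy)^\top W_q^ix}\,d\mu(y)}.$$ Assume that $T$ is $L$-Lipschitz for $W_q$ on $\mathcal P_r$, i.e. $W_q(T\mu,T\nu)\le L\,W_q(\mu,\nu)$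 for $\mu,\nu\in\mathcal P_r$, with $L>0$. Let $\varepsilon>0$. Given inputs $X^1,\dots,X^k\in (B_r)^m$ ($m\ge1$ tokens each), an output $Y=(Y^1,\dots,Y^k)\in\mathcal P_r^{\,k}$ is *$\varepsilon$-accessible* if there are a length $m_p\in\mathbb N$ and a single pre-prompt $P\in (B_r)^{m_p}$ with $W_q\big(T(\mathrm M([P,X^i])),Y^i\big)\le\varepsilon$ for all $i$. Two outputs $Y,Z$ are *$\delta$-distinct* if $W_q(Y^i,Z^i)>\delta$ for some $i$. The *proportion of $\varepsilon$-accessible outputs* is counted at resolution $3\varepsilon$: it is the fraction $|\{Y\in F: Y\ \varepsilon\text{-accessible}\}|/|F|$, where $F\subset\mathcal P_r^{\,k}$ is an inclusion-maximal family of pairwise $3\varepsilon$-distinct outputs. **Theorem.** There are constants $\rho,C_0>0$ depending only on $d$ and $q$, and constants $C=C(r,\varepsilon)>0$ depending only on $d,q,r,\varepsilon$ (not on the norm, $\tau$, $L$, $k$, $m$, the inputs or the pre-prompt length), with $$C\le C_0\exp\Big(\frac{3^d-(3r/\rho)^d}{\varepsilon^d}\Big)$$ (in particular $C\le C_0$ for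 all $\varepsilon$ as soon as $r\ge\rho$), such that the following holds. For every integer $k\ge0$ with $$k>\frac{(\frac{6Lr}{\varepsilon})^d\big(1+\log(1+(\frac{4Lr}{\varepsilon})^q)\big)}{(\frac3\varepsilon)^d-\log C},$$ (a quotient with zero denominator being read as $0$), every $m\ge1$, all inputs $X^1,\dots,X^k\in(B_r)^m$ and every maximal family $F$ as above, $F$ is finite and nonempty, and the proportion of its members that are $\varepsilon$-accessible, by pre-prompts of arbitrary length, is at most $$\beta_k:=\frac{\Big(e\big(1+(\frac{4Lr}{\varepsilon})^q\big)\Big)^{(\frac{6Lr}{\varepsilon})^d}}{\big(\frac1C\exp(\frac{3^d}{\varepsilon^d})\big)^{k}} .$$ If moreover $\log C<(3/\varepsilon)^d$, then $\beta_k<1$ for all such $k$, so not all outputs are accessible. As $k\to\infty$, $\beta_k\in O\big(\exp(-k(\frac{3^d}{\varepsilon^d}-\log C))\big)$, which is $O\big(\exp(-k\frac{3^d}{\varepsilon^d})\big)$ whenever $C\le1$ (in particular whenever $r>\rho$ and $\varepsilon$ is small enough in terms of $d,q,r$). -/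

import Mathlib

open MeasureTheory Matrix Asymptotics Filter
open scoped ENNReal

noncomputable section

/-- The parameters of a transformer layer of embedding dimension `d`: a multi-head self-attention
block (head `i` has the projections `Wq i`, `Wk i`, `Wv i`, `Wo i`) followed by an MLP block. -/
structure TransformerLayer (d : ℕ) where
  heads : ℕ
  s : ℕ
  s' : ℕ
  dff : ℕ
  Wq : Fin heads → Matrix (Fin s) (Fin d) ℝ
  Wk : Fin heads → Matrix (Fin s) (Fin d) ℝ
  Wv : Fin heads → Matrix (Fin s') (Fin d) ℝ
  Wo : Fin heads → Matrix (Fin d) (Fin s') ℝ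
  W1 : Matrix (Fin dff) (Fin d) ℝ
  W2 : Matrix (Fin d) (Fin dff) ℝ
  b1 : Fin dff → ℝ
  b2 : Fin d → ℝ

namespace TransformerLayer

variable {d : ℕ}

/-- The MLP block on one token: `W₂ ReLU(W₁ x + b₁) + b₂ + x`. -/
def mlp (ℓ : TransformerLayer d) (x : Fin d → ℝ) : Fin d → ℝ :=
  ℓ.W2 *ᵥ (fun j => max ((ℓ.W1 *ᵥ x + ℓ.b1) j) 0) + ℓ.b2 + x

/-- The unnormalised attention weight `exp ((W_k y)ᵀ (W_q x))` of head `i`. -/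
def weight (ℓ : TransformerLayer d) (i : Fin ℓ.heads) (x y : Fin d → ℝ) : ℝ :=
  Real.exp ((ℓ.Wk i *ᵥ y) ⬝ᵥ (ℓ.Wq i *ᵥ x))

/-- The mean-field self-attention vector field `Γ_μ`. -/
def attention (ℓ : TransformerLayer d) (μ : Measure (Fin d → ℝ)) (x : Fin d → ℝ) : Fin d → ℝ :=
  ∑ i, (∫ y, ℓ.weight i x y ∂μ)⁻¹ •
    ∫ y, ℓ.weight i x y • (ℓ.Wo i *ᵥ (ℓ.Wv i *ᵥ y)) ∂μ

/-- The mean-field transformer layer `μ ↦ (Δ_μ)_♯ μ`, with `Δ_μ x = MLP (Γ_μ x + x)`. -/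
def meanField (ℓ : TransformerLayer d) (μ : Measure (Fin d → ℝ)) : Measure (Fin d → ℝ) :=
  μ.map (fun x => ℓ.mlp (ℓ.attention μ x + x))

end TransformerLayer

/-- A transformer `ℒ₁ ∘ ⋯ ∘ ℒ_l` of embedding dimension `d`, given by its list of layers. -/
abbrev Transformer (d : ℕ) : Type := List (TransformerLayer d)

/-- The mean-field generalization `T` of a transformer. -/
def Transformer.meanField {d : ℕ} (τ : Transformer d) (μ : Measure (Fin d → ℝ)) :
    Measure (Fin d → ℝ) :=
  τ.foldr (fun ℓ ν => ℓ.meanField ν) μ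

/-- The empirical measure `M(X) = (1/n) ∑ᵢ δ_{Xᵢ}` of a sequence of `n` tokens. -/
def empirical {d n : ℕ} (X : Fin n → Fin d → ℝ) : Measure (Fin d → ℝ) :=
  (n : ℝ≥0∞)⁻¹ • ∑ i, Measure.dirac (X i)

/-- The `q`-Wasserstein distance associated with the norm `N` of `ℝ^d`. -/
def wasserstein {d : ℕ} (N : Seminorm ℝ (Fin d → ℝ)) (q : ℝ) (μ ν : Measure (Fin d → ℝ)) : ℝ≥0∞ :=
  (⨅ (π : Measure ((Fin d → ℝ) × (Fin d → ℝ)))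
    (_ : π.map Prod.fst = μ ∧ π.map Prod.snd = ν),
      ∫⁻ z, ENNReal.ofReal (N (z.1 - z.2) ^ q) ∂π) ^ (1 / q)

/-- The Borel probability measures on `ℝ^d` carried by the ball `{x | N x ≤ r}`. -/
def probOnBall {d : ℕ} (N : Seminorm ℝ (Fin d → ℝ)) (r : ℝ) : Set (Measure (Fin d → ℝ)) :=
  {μ | IsProbabilityMeasure μ ∧ ∀ᵐ x ∂μ, N x ≤ r}

/-- The mean-field generalization of `τ` is `L`-Lipschitz for `W_q` on the probability measures
carried by the ball of radius `r`. -/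
def Transformer.MeanFieldLipschitz {d : ℕ} (τ : Transformer d) (N : Seminorm ℝ (Fin d → ℝ))
    (q r L : ℝ) : Prop :=
  ∀ μ ∈ probOnBall N r, ∀ ν ∈ probOnBall N r,
    wasserstein N q (τ.meanField μ) (τ.meanField ν) ≤ ENNReal.ofReal L * wasserstein N q μ ν

/-- The output distributions for `k` inputs: `k`-tuples of probability measures on the ball. -/
def outputs {d : ℕ} (N : Seminorm ℝ (Fin d → ℝ)) (r : ℝ) (k : ℕ) :
    Set (Fin k → Measure (Fin d → ℝ)) :=
  {Y | ∀ i, Y i ∈ probOnBall N r}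

/-- `δ`-distinct tuples of distributions: some component is at `W_q`-distance `> δ`. -/
def Distinct {d k : ℕ} (N : Seminorm ℝ (Fin d → ℝ)) (q δ : ℝ)
    (Y Z : Fin k → Measure (Fin d → ℝ)) : Prop :=
  ∃ i, ENNReal.ofReal δ < wasserstein N q (Y i) (Z i)

/-- `F` is an inclusion-maximal set of pairwise `δ`-distinct output distributions. -/
def IsMaximalDistinct {d k : ℕ} (N : Seminorm ℝ (Fin d → ℝ)) (q r δ : ℝ)
    (F : Set (Fin k → Measure (Fin d → ℝ))) : Prop :=
  Maximal (fun S => S ⊆ outputs N r k ∧ S.Pairwise (Distinct N q δ)) F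

/-- `Y` is `ε`-accessible by the inputs `X¹, …, Xᵏ`: a single pre-prompt `P`, of any length `mp`
and with tokens in the ball of radius `r`, brings each `T(M([P, Xⁱ]))` within `ε` of `Yⁱ`. -/
def Transformer.Accessible {d k m : ℕ} (τ : Transformer d) (N : Seminorm ℝ (Fin d → ℝ))
    (q r ε : ℝ) (X : Fin k → Fin m → Fin d → ℝ) (Y : Fin k → Measure (Fin d → ℝ)) : Prop :=
  ∃ (mp : ℕ) (P : Fin mp → Fin d → ℝ), (∀ j, N (P j) ≤ r) ∧
    ∀ i, wasserstein N q (τ.meanField (empirical (Fin.append P (X i)))) (Y i) ≤ ENNReal.ofReal ε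

/-- The proportion of the (finite) set `F` of output distributions that is `ε`-accessible. -/
def Transformer.accessibleProportion {d k m : ℕ} (τ : Transformer d)
    (N : Seminorm ℝ (Fin d → ℝ)) (q r ε : ℝ) (X : Fin k → Fin m → Fin d → ℝ)
    (F : Set (Fin k → Measure (Fin d → ℝ))) : ℝ :=
  ({Y ∈ F | τ.Accessible N q r ε X Y}.ncard : ℝ) / (F.ncard : ℝ)

/-- The threshold
`(6Lr/ε)^d (1 + log(1 + (4Lr/ε)^q)) / ((3/ε)^d - log C)` on the number `k` of inputs. -/
def memoryThreshold (d : ℕ) (q L r ε C : ℝ) : ℝ :=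
  (6 * L * r / ε) ^ d * (1 + Real.log (1 + (4 * L * r / ε) ^ q)) / ((3 / ε) ^ d - Real.log C)

/-- The bound
`(e (1 + (4Lr/ε)^q))^((6Lr/ε)^d) / ((1/C) exp(3^d/ε^d))^k`. -/
def memoryBound (d : ℕ) (q L r ε C : ℝ) (k : ℕ) : ℝ :=
  (Real.exp 1 * (1 + (4 * L * r / ε) ^ q)) ^ ((6 * L * r / ε) ^ d : ℝ) /
    (1 / C * Real.exp (3 ^ d / ε ^ d)) ^ k

end

/-! ### The Wasserstein distance -/

section Wasserstein

variable {d : ℕ} {N : Seminorm ℝ (Fin d → ℝ)} {q : ℝ}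

/-! The proportion is a quotient of two counts. Write `A` for `logNumerator d q L r ε`, `D = (3/ε)^d
- log C` and `c = 2^d (d + 2)`.

Few outputs are accessible. By the Lipschitz bound and two triangle inequalities, pre-prompts whose
empirical measures are `ε/L`-close for every input cannot reach two `3ε`-distinct outputs. Cut the
ball into `n` cells of diameter `ε/(2L)` and keep only the pre-prompt's cell masses, rounded to
multiples of `1/M`. This record determines the measures up to `ε/L` whatever the length of the
pre-prompt (`IsCellCover.wasserstein_append_le`) and takes at most `(M + 1)^n ≤ exp (c A)` values,
independently of `k`. When `2Lr ≤ ε` a single class suffices.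

Many outputs exist. Pair up the points of a `48ε`-separated set and pick one point from each pair:
the uniform measures on such choices are at distance at least `48ε` times the proportion of
differing choices. A maximal family is a `3ε`-net, so each member serves only choices in a product
of small Hamming balls, whence `(4/3)^(n k) ≤ |F|`, now with `n` pairs
(`IsMaximalDistinct.pow_le_ncard`). The constant `C` is tuned so that this is at least `exp (k c D)`
when `D > 0`.

The proportion is then at most `exp (c (A - k D))`. The threshold on `k` says `A - k D < 0`, so the
factor `c ≥ 1` may be dropped. For `D ≤ 0` the claimed bound is at least `1`. -/

theorem Seminorm.continuous_pi (N : Seminorm ℝ (Fin d → ℝ)) : Continuous N := by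
  rw [← continuousOn_univ]
  exact N.convexOn.continuousOn isOpen_univ

theorem measurable_cost (N : Seminorm ℝ (Fin d → ℝ)) (q : ℝ) :
    Measurable fun z : (Fin d → ℝ) × (Fin d → ℝ) => ENNReal.ofReal (N (z.1 - z.2) ^ q) := by
  have h : Measurable fun z : (Fin d → ℝ) × (Fin d → ℝ) => N (z.1 - z.2) :=
    (N.continuous_pi.comp (continuous_fst.sub continuous_snd)).measurable
  exact (h.pow_const q).ennreal_ofReal

theorem wasserstein_le_of_coupling (hq : 1 ≤ q) {μ ν : Measure (Fin d → ℝ)}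
    (π : Measure ((Fin d → ℝ) × (Fin d → ℝ))) (h₁ : π.map Prod.fst = μ)
    (h₂ : π.map Prod.snd = ν) :
    wasserstein N q μ ν ≤ (∫⁻ z, ENNReal.ofReal (N (z.1 - z.2) ^ q) ∂π) ^ (1 / q) :=
  ENNReal.rpow_le_rpow (iInf₂_le π ⟨h₁, h₂⟩) (by positivity)

theorem le_wasserstein (hq : 1 ≤ q) {μ ν : Measure (Fin d → ℝ)} {a : ℝ≥0∞}
    (h : ∀ π : Measure ((Fin d → ℝ) × (Fin d → ℝ)), π.map Prod.fst = μ → π.map Prod.snd = ν →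
      a ≤ (∫⁻ z, ENNReal.ofReal (N (z.1 - z.2) ^ q) ∂π) ^ (1 / q)) :
    a ≤ wasserstein N q μ ν := by
  have hq0 : 0 < q := by linarith
  rw [wasserstein, one_div, ENNReal.le_rpow_inv_iff hq0]
  refine le_iInf₂ fun π hπ => ?_
  rw [← ENNReal.le_rpow_inv_iff hq0, ← one_div]
  exact h π hπ.1 hπ.2

/-- Monotonicity of the root lets it pass inside the infimum, so that the triangle inequality can be
proved one pair of couplings at a time. -/
theorem wasserstein_eq_iInf (hq : 1 ≤ q) (μ ν : Measure (Fin d → ℝ)) :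
    wasserstein N q μ ν =
      ⨅ π : {π : Measure ((Fin d → ℝ) × (Fin d → ℝ)) //
        π.map Prod.fst = μ ∧ π.map Prod.snd = ν},
        (∫⁻ z, ENNReal.ofReal (N (z.1 - z.2) ^ q) ∂π.1) ^ (1 / q) :=
  le_antisymm (le_iInf fun π => wasserstein_le_of_coupling hq π.1 π.2.1 π.2.2)
    (le_wasserstein hq fun π h₁ h₂ => iInf_le_of_le ⟨π, h₁, h₂⟩ le_rfl)

theorem wasserstein_self (hq : 1 ≤ q) (μ : Measure (Fin d → ℝ)) : wasserstein N q μ μ = 0 := by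
  have hq0 : 0 < q := by linarith
  have hm : Measurable fun x : Fin d → ℝ => (x, x) := measurable_id.prodMk measurable_id
  have h := wasserstein_le_of_coupling (N := N) hq (μ := μ) (ν := μ) (μ.map fun x => (x, x))
    (by rw [Measure.map_map measurable_fst hm]; exact Measure.map_id)
    (by rw [Measure.map_map measurable_snd hm]; exact Measure.map_id)
  rw [lintegral_map (measurable_cost N q) hm] at h
  simpa [Real.zero_rpow hq0.ne', hq0] using h

theorem wasserstein_comm (hq : 1 ≤ q) (μ ν : Measure (Fin d → ℝ)) :
    wasserstein N q μ ν = wasserstein N q ν μ := by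
  have key : ∀ μ ν : Measure (Fin d → ℝ), wasserstein N q μ ν ≤ wasserstein N q ν μ := by
    intro μ ν
    refine le_wasserstein hq fun π h₁ h₂ => ?_
    have h := wasserstein_le_of_coupling (N := N) hq (μ := μ) (ν := ν) (π.map Prod.swap)
      (by rw [Measure.map_map measurable_fst measurable_swap]; exact h₂)
      (by rw [Measure.map_map measurable_snd measurable_swap]; exact h₁)
    rw [lintegral_map (measurable_cost N q) measurable_swap] at h
    refine h.trans_eq ?_
    congr 1
    refine lintegral_congr fun z => ?_
    rw [Prod.fst_swap, Prod.snd_swap, map_sub_rev]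
  exact le_antisymm (key μ ν) (key ν μ)

/-- Two couplings with a common middle marginal can be glued. -/
theorem exists_gluing {E : Type*} [MeasurableSpace E] [StandardBorelSpace E] [Nonempty E]
    (π₁ π₂ : Measure (E × E)) [IsFiniteMeasure π₁] [IsFiniteMeasure π₂]
    (h : π₁.map Prod.snd = π₂.map Prod.fst) :
    ∃ γ : Measure ((E × E) × E), γ.map Prod.fst = π₁ ∧
      γ.map (fun z => (z.1.2, z.2)) = π₂ := by
  -- Draw `(x, y)` from `π₁`, then `z` from the conditional law of `π₂` given its first coordinate
  -- `y`.
  refine ⟨π₁.compProd (π₂.condKernel.comap Prod.snd measurable_snd), ?_, ?_⟩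
  · exact Measure.fst_compProd _ _
  · have hm : Measurable fun z : (E × E) × E => (z.1.2, z.2) := by fun_prop
    ext s hs
    rw [Measure.map_apply hm hs, Measure.compProd_apply (hm hs)]
    conv_rhs => rw [← π₂.disintegrate π₂.condKernel, Measure.compProd_apply hs, Measure.fst, ← h]
    rw [lintegral_map (ProbabilityTheory.Kernel.measurable_kernel_prodMk_left hs) measurable_snd]
    rfl

/-- Glue the two couplings along `ν` and apply Minkowski's inequality in `L^q`. Finiteness of `μ`
passes to `π₁`, `ν` and `π₂` through the shared marginals. -/
theorem wasserstein_triangle (hq : 1 ≤ q) (μ ν κ : Measure (Fin d → ℝ)) [IsFiniteMeasure μ] :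
    wasserstein N q μ κ ≤ wasserstein N q μ ν + wasserstein N q ν κ := by
  have hq0 : 0 < q := by linarith
  rw [wasserstein_eq_iInf hq μ ν, wasserstein_eq_iInf hq ν κ]
  refine ENNReal.le_iInf_add_iInf fun ⟨π₁, h₁, h₁'⟩ ⟨π₂, h₂, h₂'⟩ => ?_
  have f₁ : IsFiniteMeasure π₁ := by
    subst h₁
    exact Measure.isFiniteMeasure_of_map measurable_fst.aemeasurable
  have f₂ : IsFiniteMeasure π₂ := by
    have : IsFiniteMeasure ν := by rw [← h₁']; infer_instance
    subst h₂
    exact Measure.isFiniteMeasure_of_map measurable_fst.aemeasurable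
  obtain ⟨γ, g₁, g₂⟩ := exists_gluing π₁ π₂ (h₁'.trans h₂.symm)
  have hm : Measurable fun z : ((Fin d → ℝ) × (Fin d → ℝ)) × (Fin d → ℝ) => (z.1.2, z.2) := by
    fun_prop
  have hm' : Measurable fun z : ((Fin d → ℝ) × (Fin d → ℝ)) × (Fin d → ℝ) => (z.1.1, z.2) := by
    fun_prop
  have hle := wasserstein_le_of_coupling (N := N) hq (μ := μ) (ν := κ)
    (γ.map fun z => (z.1.1, z.2))
    (by rw [Measure.map_map measurable_fst hm', ← h₁, ← g₁,
          Measure.map_map measurable_fst measurable_fst]; rfl)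
    (by rw [Measure.map_map measurable_snd hm', ← h₂', ← g₂,
          Measure.map_map measurable_snd hm]; rfl)
  refine hle.trans ?_
  simp only [← g₁, ← g₂]
  rw [lintegral_map (measurable_cost N q) hm',
    lintegral_map (measurable_cost N q) hm, lintegral_map (measurable_cost N q) measurable_fst]
  have hN : ∀ x, 0 ≤ N x := fun x => apply_nonneg N x
  simp only [← ENNReal.ofReal_rpow_of_nonneg (hN _) hq0.le]
  refine le_trans (ENNReal.rpow_le_rpow (lintegral_mono fun z => ?_) (by positivity))
    (ENNReal.lintegral_Lp_add_le (μ := γ)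
      (f := fun z => ENNReal.ofReal (N (z.1.1 - z.1.2)))
      (g := fun z => ENNReal.ofReal (N (z.1.2 - z.2))) ?_ ?_ hq)
  · refine ENNReal.rpow_le_rpow ?_ hq0.le
    simp only [Pi.add_apply]
    rw [← ENNReal.ofReal_add (hN _) (hN _)]
    refine ENNReal.ofReal_le_ofReal ?_
    calc N (z.1.1 - z.2) = N ((z.1.1 - z.1.2) + (z.1.2 - z.2)) := by congr 1; abel
      _ ≤ _ := map_add_le_add _ _ _
  · have : Continuous fun z : ((Fin d → ℝ) × (Fin d → ℝ)) × (Fin d → ℝ) => N (z.1.1 - z.1.2) :=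
      N.continuous_pi.comp (by fun_prop)
    exact this.measurable.ennreal_ofReal.aemeasurable
  · have : Continuous fun z : ((Fin d → ℝ) × (Fin d → ℝ)) × (Fin d → ℝ) => N (z.1.2 - z.2) :=
      N.continuous_pi.comp (by fun_prop)
    exact this.measurable.ennreal_ofReal.aemeasurable

end Wasserstein

/-! ### Couplings adapted to a finite partition -/

section Cells

/-- Marginal computation for the coupling below: the products inside the cells and the normalised
product of the leftovers add up to the given measure. For `R = 0` the leftover vanishes and `⊤ * 0 =
0`. -/
theorem ENNReal.sum_split_eq {ι : Type*} [Fintype ι] {c m q : ι → ℝ≥0∞} {R : ℝ≥0∞}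
    (hqc : ∀ j, q j * c j ≤ 1) (hR : R ≠ ⊤) (h : ∑ j, (1 - q j * c j) * m j ≤ R) :
    ∑ j, c j * (m j * q j) + R⁻¹ * ((∑ j, (1 - q j * c j) * m j) * R) = ∑ j, m j := by
  have h₁ : R⁻¹ * ((∑ j, (1 - q j * c j) * m j) * R) = ∑ j, (1 - q j * c j) * m j := by
    rcases eq_or_ne R 0 with rfl | hR0
    · rw [nonpos_iff_eq_zero.1 h]; simp
    · rw [mul_comm, mul_assoc, ENNReal.mul_inv_cancel hR0 hR, mul_one]
  rw [h₁, ← Finset.sum_add_distrib]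
  refine Finset.sum_congr rfl fun j _ => ?_
  calc c j * (m j * q j) + (1 - q j * c j) * m j
      = (q j * c j + (1 - q j * c j)) * m j := by ring
    _ = m j := by rw [add_tsub_cancel_of_le (hqc j), one_mul]

theorem MeasureTheory.Measure.eq_sum_inter {ι E : Type*} [Fintype ι] [MeasurableSpace E]
    {μ : Measure E} {C : ι → Set E} (hC : ∀ j, MeasurableSet (C j))
    (hd : Pairwise (Function.onFun Disjoint C)) (hμ : ∀ᵐ x ∂μ, ∃ j, x ∈ C j) {s : Set E}
    (hs : MeasurableSet s) : μ s = ∑ j, μ (s ∩ C j) := by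
  have h : μ s = μ (⋃ j, s ∩ C j) := by
    refine measure_congr ?_
    filter_upwards [hμ] with x hx
    refine propext ⟨fun h => Set.mem_iUnion.2 (hx.imp fun j hj => ⟨h, hj⟩), fun h => ?_⟩
    obtain ⟨j, hj⟩ := Set.mem_iUnion.1 h
    exact hj.1
  rw [h, measure_iUnion _ fun j => hs.inter (hC j), tsum_fintype]
  exact fun i j hij => (hd hij).mono Set.inter_subset_right Set.inter_subset_right

/-- If `μ` and `ν` both give mass at least `w j` to the cell `C j`, there is a coupling of them
that gives mass at most `1 - ∑ w j` to the pairs that do not lie in a common cell. -/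
theorem exists_coupling_of_cells {ι E : Type*} [Fintype ι] [MeasurableSpace E]
    (μ ν : Measure E) [IsProbabilityMeasure μ] [IsProbabilityMeasure ν] {C : ι → Set E}
    (hC : ∀ j, MeasurableSet (C j)) (hd : Pairwise (Function.onFun Disjoint C))
    (hμ : ∀ᵐ x ∂μ, ∃ j, x ∈ C j) (hν : ∀ᵐ x ∂ν, ∃ j, x ∈ C j) {w : ι → ℝ≥0∞}
    (hwμ : ∀ j, w j ≤ μ (C j)) (hwν : ∀ j, w j ≤ ν (C j)) :
    ∃ π : Measure (E × E), π.map Prod.fst = μ ∧ π.map Prod.snd = ν ∧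
      π (⋃ j, C j ×ˢ C j)ᶜ ≤ 1 - ∑ j, w j := by
  set p : ι → ℝ≥0∞ := fun j => μ (C j) with hp
  set q : ι → ℝ≥0∞ := fun j => ν (C j) with hq
  -- With this weight the product measure on cell `j` has mass `p j * q j / max (p j) (q j) = min (p
  -- j) (q j)`. On a cell null for both measures `c j = ⊤`, harmless since it only multiplies `0`.
  set c : ι → ℝ≥0∞ := fun j => (max (p j) (q j))⁻¹ with hc
  have hpc : ∀ j, p j * c j ≤ 1 := fun j =>
    ENNReal.div_le_of_le_mul (by rw [one_mul]; exact le_max_left _ _)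
  have hqc : ∀ j, q j * c j ≤ 1 := fun j =>
    ENNReal.div_le_of_le_mul (by rw [one_mul]; exact le_max_right _ _)
  have hp1 : ∑ j, p j = 1 := by
    have := Measure.eq_sum_inter hC hd hμ MeasurableSet.univ
    simpa using this.symm
  have hq1 : ∑ j, q j = 1 := by
    have := Measure.eq_sum_inter hC hd hν MeasurableSet.univ
    simpa using this.symm
  set s : ℝ≥0∞ := ∑ j, p j * q j * c j with hs
  have hs₁ : ∑ j, (1 - q j * c j) * p j + s = 1 := by
    rw [hs, ← Finset.sum_add_distrib]
    refine (Finset.sum_congr rfl fun j _ => ?_).trans hp1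
    calc (1 - q j * c j) * p j + p j * q j * c j
        = (q j * c j + (1 - q j * c j)) * p j := by ring
      _ = p j := by rw [add_tsub_cancel_of_le (hqc j), one_mul]
  have hs₂ : ∑ j, (1 - p j * c j) * q j + s = 1 := by
    rw [hs, ← Finset.sum_add_distrib]
    refine (Finset.sum_congr rfl fun j _ => ?_).trans hq1
    calc (1 - p j * c j) * q j + p j * q j * c j
        = (p j * c j + (1 - p j * c j)) * q j := by ring
      _ = q j := by rw [add_tsub_cancel_of_le (hpc j), one_mul]
  have hsT : s ≠ ⊤ := ne_top_of_le_ne_top ENNReal.one_ne_top (hs₁ ▸ le_add_self)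
  set R : ℝ≥0∞ := 1 - s with hR
  have hRT : R ≠ ⊤ := ne_top_of_le_ne_top ENNReal.one_ne_top tsub_le_self
  have hR₁ : ∑ j, (1 - q j * c j) * p j = R := ENNReal.eq_sub_of_add_eq hsT hs₁
  have hR₂ : ∑ j, (1 - p j * c j) * q j = R := ENNReal.eq_sub_of_add_eq hsT hs₂
  set μ' : Measure E := ∑ j, (1 - q j * c j) • μ.restrict (C j) with hμ'
  set ν' : Measure E := ∑ j, (1 - p j * c j) • ν.restrict (C j) with hν'
  have hμ'a : ∀ t, MeasurableSet t → μ' t = ∑ j, (1 - q j * c j) * μ (t ∩ C j) := by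
    intro t ht
    simp [hμ', Measure.finsetSum_apply, Measure.restrict_apply ht]
  have hν'a : ∀ t, MeasurableSet t → ν' t = ∑ j, (1 - p j * c j) * ν (t ∩ C j) := by
    intro t ht
    simp [hν', Measure.finsetSum_apply, Measure.restrict_apply ht]
  have hμ'u : μ' Set.univ = R := by rw [hμ'a _ MeasurableSet.univ, ← hR₁]; simp [hp]
  have hν'u : ν' Set.univ = R := by rw [hν'a _ MeasurableSet.univ, ← hR₂]; simp [hq]
  have : IsFiniteMeasure μ' := ⟨by rw [hμ'u]; exact hRT.lt_top⟩
  have : IsFiniteMeasure ν' := ⟨by rw [hν'u]; exact hRT.lt_top⟩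
  refine ⟨∑ j, c j • (μ.restrict (C j)).prod (ν.restrict (C j)) + R⁻¹ • μ'.prod ν', ?_, ?_, ?_⟩
  · ext t ht
    rw [Measure.map_apply measurable_fst ht, ← Set.prod_univ]
    simp only [Measure.add_apply, Measure.finsetSum_apply, Measure.smul_apply, Measure.prod_prod,
      hν'u, hμ'a t ht, Measure.restrict_apply ht, Measure.restrict_apply_univ, smul_eq_mul]
    rw [Measure.eq_sum_inter hC hd hμ ht]
    refine ENNReal.sum_split_eq hqc hRT (hR₁ ▸ Finset.sum_le_sum fun j _ => ?_)
    exact mul_le_mul_right (measure_mono Set.inter_subset_right) _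
  · ext t ht
    rw [Measure.map_apply measurable_snd ht, ← Set.univ_prod]
    simp only [Measure.add_apply, Measure.finsetSum_apply, Measure.smul_apply, Measure.prod_prod,
      hμ'u, hν'a t ht, Measure.restrict_apply ht, Measure.restrict_apply_univ, smul_eq_mul]
    rw [Measure.eq_sum_inter hC hd hν ht]
    simp_rw [mul_comm (μ _) (ν _), mul_comm R]
    refine ENNReal.sum_split_eq hpc hRT (hR₂ ▸ Finset.sum_le_sum fun j _ => ?_)
    exact mul_le_mul_right (measure_mono Set.inter_subset_right) _
  · have h₁ : ∀ j, ((μ.restrict (C j)).prod (ν.restrict (C j))) (⋃ j, C j ×ˢ C j)ᶜ = 0 := by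
      intro j
      rw [Measure.prod_restrict, Measure.restrict_apply
        (MeasurableSet.iUnion fun j => (hC j).prod (hC j)).compl]
      refine measure_mono_null (fun z hz => ?_) measure_empty
      exact (hz.1 (Set.mem_iUnion.2 ⟨j, hz.2⟩)).elim
    simp only [Measure.add_apply, Measure.finsetSum_apply, Measure.smul_apply, h₁, mul_zero,
      Finset.sum_const_zero, zero_add, smul_eq_mul]
    have h₂ : R⁻¹ * (μ'.prod ν') (⋃ j, C j ×ˢ C j)ᶜ ≤ R := by
      calc R⁻¹ * (μ'.prod ν') (⋃ j, C j ×ˢ C j)ᶜ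
          ≤ R⁻¹ * (μ'.prod ν') (Set.univ ×ˢ Set.univ) := by gcongr; simp
        _ = R⁻¹ * R * R := by rw [Measure.prod_prod, hμ'u, hν'u, mul_assoc]
        _ ≤ 1 * R := by gcongr; exact ENNReal.inv_mul_le_one R
        _ = R := one_mul R
    refine h₂.trans (tsub_le_tsub_left (Finset.sum_le_sum fun j _ => ?_) 1)
    have hm : w j ≤ min (p j) (q j) := le_min (hwμ j) (hwν j)
    rcases eq_or_ne (max (p j) (q j)) 0 with h0 | h0
    · have : p j = 0 := nonpos_iff_eq_zero.1 (h0 ▸ le_max_left _ _)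
      exact (hm.trans ((min_le_left _ _).trans this.le)).trans zero_le
    · have hT : max (p j) (q j) ≠ ⊤ := max_ne_top (measure_ne_top _ _) (measure_ne_top _ _)
      refine hm.trans_eq ?_
      rw [← min_mul_max (p j) (q j), hc, mul_assoc, ENNReal.mul_inv_cancel h0 hT, mul_one]

/-- Pairs in a common cell cost at most `a ^ q`; the others, of mass at most `1 - ∑ w j`, cost at
most `(2r) ^ q`. -/
theorem wasserstein_le_of_cells {ι : Type*} [Fintype ι] {d : ℕ} {N : Seminorm ℝ (Fin d → ℝ)}
    {q r a : ℝ} (hq : 1 ≤ q) {μ ν : Measure (Fin d → ℝ)}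
    (hμ : μ ∈ probOnBall N r) (hν : ν ∈ probOnBall N r) {C : ι → Set (Fin d → ℝ)}
    (hC : ∀ j, MeasurableSet (C j)) (hd : Pairwise (Function.onFun Disjoint C))
    (hcov : ∀ x, N x ≤ r → ∃ j, x ∈ C j) (hdiam : ∀ j, ∀ x ∈ C j, ∀ y ∈ C j, N (x - y) ≤ a)
    {w : ι → ℝ≥0∞} (hwμ : ∀ j, w j ≤ μ (C j)) (hwν : ∀ j, w j ≤ ν (C j)) :
    wasserstein N q μ ν ≤
      (ENNReal.ofReal (a ^ q) + ENNReal.ofReal ((2 * r) ^ q) * (1 - ∑ j, w j)) ^ (1 / q) := by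
  have hq0 : 0 < q := by linarith
  obtain ⟨_, hμr⟩ := hμ
  obtain ⟨_, hνr⟩ := hν
  obtain ⟨π, h₁, h₂, h₃⟩ := exists_coupling_of_cells μ ν hC hd
    (hμr.mono fun x hx => hcov x hx) (hνr.mono fun x hx => hcov x hx) hwμ hwν
  refine (wasserstein_le_of_coupling hq π h₁ h₂).trans
    (ENNReal.rpow_le_rpow ?_ (by positivity))
  have hπ : π Set.univ = 1 := by
    have : μ Set.univ = 1 := measure_univ
    rwa [← h₁, Measure.map_apply measurable_fst MeasurableSet.univ] at this
  set D : Set ((Fin d → ℝ) × (Fin d → ℝ)) := ⋃ j, C j ×ˢ C j with hD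
  have hDm : MeasurableSet D := MeasurableSet.iUnion fun j => (hC j).prod (hC j)
  have e₁ : ∀ᵐ z ∂π, N z.1 ≤ r := by
    rw [← h₁] at hμr
    exact ae_of_ae_map measurable_fst.aemeasurable hμr
  have e₂ : ∀ᵐ z ∂π, N z.2 ≤ r := by
    rw [← h₂] at hνr
    exact ae_of_ae_map measurable_snd.aemeasurable hνr
  calc ∫⁻ z, ENNReal.ofReal (N (z.1 - z.2) ^ q) ∂π
      ≤ ∫⁻ z, (ENNReal.ofReal (a ^ q) + Dᶜ.indicator (fun _ => ENNReal.ofReal ((2 * r) ^ q)) z)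
          ∂π := by
        refine lintegral_mono_ae ?_
        filter_upwards [e₁, e₂] with z hz₁ hz₂
        by_cases hz : z ∈ D
        · obtain ⟨j, hj⟩ := Set.mem_iUnion.1 hz
          refine le_add_right (ENNReal.ofReal_le_ofReal ?_)
          exact Real.rpow_le_rpow (apply_nonneg N _) (hdiam j _ hj.1 _ hj.2) hq0.le
        · rw [Set.indicator_of_mem (Set.mem_compl hz)]
          refine le_add_left (ENNReal.ofReal_le_ofReal ?_)
          refine Real.rpow_le_rpow (apply_nonneg N _) ?_ hq0.le
          linarith [map_sub_le_add N z.1 z.2]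
    _ = ENNReal.ofReal (a ^ q) + ENNReal.ofReal ((2 * r) ^ q) * π Dᶜ := by
        rw [lintegral_add_left measurable_const, lintegral_const, hπ, mul_one,
          lintegral_indicator_const hDm.compl]
    _ ≤ _ := by gcongr

end Cells

/-! ### Separated sets in a ball -/

section Separated

variable {d : ℕ} {N : Seminorm ℝ (Fin d → ℝ)}

theorem Seminorm.exists_mul_norm_le (hN : ∀ x, N x = 0 → x = 0) :
    ∃ c : ℝ, 0 < c ∧ ∀ x, c * ‖x‖ ≤ N x := by
  -- The unit sphere is empty exactly when `d = 0`.
  rcases (Metric.sphere (0 : Fin d → ℝ) 1).eq_empty_or_nonempty with h | h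
  · refine ⟨1, one_pos, fun x => ?_⟩
    rcases eq_or_ne x 0 with rfl | hx
    · simp
    · refine absurd (h ▸ ?_ : ‖x‖⁻¹ • x ∈ (∅ : Set (Fin d → ℝ))) (Set.notMem_empty _)
      rw [mem_sphere_zero_iff_norm, norm_smul, norm_inv, norm_norm,
        inv_mul_cancel₀ (norm_ne_zero_iff.2 hx)]
  · obtain ⟨x₀, hx₀, hmin⟩ :=
      (isCompact_sphere (0 : Fin d → ℝ) 1).exists_isMinOn h N.continuous_pi.continuousOn
    have hx₀' : x₀ ≠ 0 := by
      rintro rfl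
      simp at hx₀
    refine ⟨N x₀, (apply_nonneg N x₀).lt_of_ne fun h0 => hx₀' (hN _ h0.symm), fun x => ?_⟩
    rcases eq_or_ne x 0 with rfl | hx
    · simp
    · have hx' := norm_ne_zero_iff.2 hx
      have h₁ : ‖x‖⁻¹ • x ∈ Metric.sphere (0 : Fin d → ℝ) 1 := by
        rw [mem_sphere_zero_iff_norm, norm_smul, norm_inv, norm_norm, inv_mul_cancel₀ hx']
      have h₂ : N x₀ ≤ N (‖x‖⁻¹ • x) := hmin h₁
      rw [map_smul_eq_mul, norm_inv, norm_norm, inv_mul_eq_div,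
        le_div_iff₀ (norm_pos_iff.2 hx)] at h₂
      exact h₂

theorem Seminorm.measurableSet_le (N : Seminorm ℝ (Fin d → ℝ)) (c : Fin d → ℝ) (r : ℝ) :
    MeasurableSet {x | N (x - c) ≤ r} :=
  (isClosed_le (N.continuous_pi.comp (continuous_id.sub continuous_const))
    continuous_const).measurableSet

theorem Seminorm.volume_le_one_ne_zero (N : Seminorm ℝ (Fin d → ℝ)) :
    volume {x | N x ≤ 1} ≠ 0 := by
  have ho : IsOpen {x | N x < 1} := isOpen_lt N.continuous_pi continuous_const
  have h : 0 < volume {x | N x < 1} := ho.measure_pos volume ⟨0, by simp⟩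
  exact (h.trans_le (measure_mono fun x (hx : N x < 1) => hx.le)).ne'

theorem Seminorm.volume_le_one_ne_top (hN : ∀ x, N x = 0 → x = 0) :
    volume {x | N x ≤ 1} ≠ ⊤ := by
  obtain ⟨c, hc, h⟩ := N.exists_mul_norm_le hN
  refine (Bornology.IsBounded.measure_lt_top
    ((Metric.isBounded_closedBall (x := (0 : Fin d → ℝ)) (r := 1 / c)).subset
      fun x (hx : N x ≤ 1) => ?_)).ne
  rw [mem_closedBall_zero_iff, le_div_iff₀ hc, mul_comm]
  exact (h x).trans hx

open scoped Pointwise in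
theorem Seminorm.volume_le (N : Seminorm ℝ (Fin d → ℝ)) (c : Fin d → ℝ) {r : ℝ} (hr : 0 < r) :
    volume {x | N (x - c) ≤ r} = ENNReal.ofReal (r ^ d) * volume {x | N x ≤ 1} := by
  have h₁ : volume {x | N (x - c) ≤ r} = volume {x | N x ≤ r} :=
    by
    simpa [sub_eq_add_neg] using measure_preimage_add_right volume (-c) {x | N x ≤ r}
  have h₂ : {x | N x ≤ r} = r • {x | N x ≤ 1} := by
    ext x
    rw [Set.mem_smul_set_iff_inv_smul_mem₀ hr.ne', Set.mem_ofPred_eq, Set.mem_ofPred_eq,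
      map_smul_eq_mul, norm_inv, Real.norm_of_nonneg hr.le, inv_mul_le_iff₀ hr, mul_one]
  rw [h₁, h₂, Measure.addHaar_smul_of_nonneg volume hr.le]
  simp

/-- A set of points of the ball of radius `r` that are at mutual distance `> η`. -/
def IsSeparatedInBall (N : Seminorm ℝ (Fin d → ℝ)) (r η : ℝ) (S : Finset (Fin d → ℝ)) : Prop :=
  (∀ x ∈ S, N x ≤ r) ∧ ∀ x ∈ S, ∀ y ∈ S, x ≠ y → η < N (x - y)

/-- The `N`-balls of radius `η / 2` around the points are disjoint and lie in the ball of radius `r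
+ η / 2`. The volume of the unit ball cancels, so the bound does not depend on the norm. -/
theorem IsSeparatedInBall.card_le (hN : ∀ x, N x = 0 → x = 0) {r η : ℝ} (hr : 0 < r) (hη : 0 < η)
    {S : Finset (Fin d → ℝ)} (hS : IsSeparatedInBall N r η S) :
    (S.card : ℝ) ≤ (1 + 2 * r / η) ^ d := by
  have hV0 := N.volume_le_one_ne_zero
  have hVT := N.volume_le_one_ne_top hN
  have hdisj : Set.PairwiseDisjoint (S : Set (Fin d → ℝ)) fun c => {x | N (x - c) ≤ η / 2} := by
    intro x hx y hy hxy
    refine Set.disjoint_left.2 fun z (hz : N (z - x) ≤ _) (hz' : N (z - y) ≤ _) => ?_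
    have h₁ := hS.2 x hx y hy hxy
    have h₂ := map_sub_le_add N (z - y) (z - x)
    rw [sub_sub_sub_cancel_left] at h₂
    linarith
  have h₁ : volume (⋃ c ∈ S, {x | N (x - c) ≤ η / 2}) ≤ volume {x | N (x - 0) ≤ r + η / 2} := by
    refine measure_mono fun z hz => ?_
    simp only [Set.mem_iUnion, Set.mem_ofPred_eq, exists_prop, sub_zero] at hz ⊢
    obtain ⟨c, hc, hz⟩ := hz
    have h₂ := map_add_le_add N (z - c) c
    rw [sub_add_cancel] at h₂
    linarith [hS.1 c hc]
  rw [measure_biUnion_finset hdisj fun c _ => N.measurableSet_le c _,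
    N.volume_le _ (by positivity)] at h₁
  simp only [N.volume_le _ (half_pos hη), Finset.sum_const, nsmul_eq_mul] at h₁
  rw [← mul_assoc, ENNReal.mul_le_mul_iff_left hV0 hVT, ← ENNReal.ofReal_natCast,
    ← ENNReal.ofReal_mul (by positivity), ENNReal.ofReal_le_ofReal_iff (by positivity)] at h₁
  have h₂ : (1 + 2 * r / η) = (r + η / 2) / (η / 2) := by field_simp; ring
  rw [h₂, div_pow, le_div_iff₀ (by positivity)]
  exact h₁

/-- A maximal separated set is a net; its cardinality is controlled from both sides. -/
theorem exists_separated_net (hN : ∀ x, N x = 0 → x = 0) {r η : ℝ} (hr : 0 < r) (hη : 0 < η) :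
    ∃ S : Finset (Fin d → ℝ), IsSeparatedInBall N r η S ∧
      (∀ x, N x ≤ r → ∃ y ∈ S, N (x - y) ≤ η) ∧ (S.card : ℝ) ≤ (1 + 2 * r / η) ^ d ∧
      (r / η) ^ d ≤ S.card := by
  classical
  let A : Set ℕ := {n | ∃ S, IsSeparatedInBall N r η S ∧ S.card = n}
  have hA : BddAbove A := by
    refine ⟨⌊(1 + 2 * r / η) ^ d⌋₊, ?_⟩
    rintro _ ⟨S, hS, rfl⟩
    exact Nat.le_floor (hS.card_le hN hr hη)
  have hA' : A.Nonempty := ⟨0, ∅, by simp [IsSeparatedInBall], rfl⟩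
  obtain ⟨S, hS, hcard⟩ := Nat.sSup_mem hA' hA
  have hcov : ∀ x, N x ≤ r → ∃ y ∈ S, N (x - y) ≤ η := by
    intro x hx
    by_contra! h
    have hxS : x ∉ S := fun hxS => by
      have := h x hxS
      rw [sub_self, map_zero] at this
      exact hη.not_gt this
    have h₁ : IsSeparatedInBall N r η (insert x S) := by
      refine ⟨fun y hy => ?_, fun y hy z hz hyz => ?_⟩
      · rcases Finset.mem_insert.1 hy with rfl | hy
        exacts [hx, hS.1 y hy]
      · rcases Finset.mem_insert.1 hy with rfl | hy' <;>
          rcases Finset.mem_insert.1 hz with rfl | hz'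
        · exact absurd rfl hyz
        · exact h z hz'
        · rw [map_sub_rev]; exact h y hy'
        · exact hS.2 y hy' z hz' hyz
    have h₂ : (insert x S).card ≤ sSup A := le_csSup hA ⟨_, h₁, rfl⟩
    rw [Finset.card_insert_of_notMem hxS, hcard] at h₂
    omega
  refine ⟨S, hS, hcov, hS.card_le hN hr hη, ?_⟩
  -- Lower bound: the balls of radius `η` around the net cover the ball of radius `r`; compare
  -- volumes.
  have hV0 := N.volume_le_one_ne_zero
  have hVT := N.volume_le_one_ne_top hN
  have h₁ : volume {x | N (x - 0) ≤ r} ≤ ∑ c ∈ S, volume {x | N (x - c) ≤ η} := by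
    refine (measure_mono fun z hz => ?_).trans (measure_biUnion_finset_le S _)
    simp only [Set.mem_iUnion, Set.mem_ofPred_eq, exists_prop, sub_zero] at hz ⊢
    exact hcov z hz
  rw [N.volume_le _ hr] at h₁
  simp only [N.volume_le _ hη, Finset.sum_const, nsmul_eq_mul] at h₁
  rw [← mul_assoc, ENNReal.mul_le_mul_iff_left hV0 hVT, ← ENNReal.ofReal_natCast,
    ← ENNReal.ofReal_mul (by positivity), ENNReal.ofReal_le_ofReal_iff (by positivity)] at h₁
  rw [div_pow, div_le_iff₀ (by positivity)]
  exact h₁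

/-- The ball of radius `r` is covered by at most `(1 + 4 r / a) ^ d` disjoint measurable cells of
diameter at most `a`. -/
theorem exists_cells (hN : ∀ x, N x = 0 → x = 0) {r a : ℝ} (hr : 0 < r) (ha : 0 < a) :
    ∃ (n : ℕ) (C : Fin n → Set (Fin d → ℝ)), 0 < n ∧ (n : ℝ) ≤ (1 + 4 * r / a) ^ d ∧
      (∀ j, MeasurableSet (C j)) ∧ Pairwise (Function.onFun Disjoint C) ∧
      (∀ x, N x ≤ r → ∃ j, x ∈ C j) ∧ ∀ j, ∀ x ∈ C j, ∀ y ∈ C j, N (x - y) ≤ a := by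
  obtain ⟨S, -, hcov, hcard, -⟩ := exists_separated_net hN hr (half_pos ha)
  let e := S.equivFin.symm
  let f : Fin S.card → Set (Fin d → ℝ) := fun j => {x | N (x - e j) ≤ a / 2}
  refine ⟨S.card, disjointed f, ?_, ?_, fun j => ?_, disjoint_disjointed f, fun x hx => ?_,
    fun j x hx y hy => ?_⟩
  · obtain ⟨y, hy, -⟩ := hcov 0 (by simpa using hr.le)
    exact Finset.card_pos.2 ⟨y, hy⟩
  · convert hcard using 3
    field_simp
    norm_num
  · rw [disjointed_eq_inter_compl]
    exact (N.measurableSet_le _ _).inter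
      (MeasurableSet.iInter fun i => MeasurableSet.iInter fun _ => (N.measurableSet_le _ _).compl)
  · rw [← Set.mem_iUnion, iUnion_disjointed, Set.mem_iUnion]
    obtain ⟨y, hy, hxy⟩ := hcov x hx
    exact ⟨S.equivFin ⟨y, hy⟩, by simpa [f, e] using hxy⟩
  · have h₁ : N (x - e j) ≤ a / 2 := disjointed_subset f j hx
    have h₂ : N (y - e j) ≤ a / 2 := disjointed_subset f j hy
    have h₃ := map_sub_le_add N (x - e j) (y - e j)
    rw [sub_sub_sub_cancel_right] at h₃
    linarith

end Separated

/-! ### Empirical measures -/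

section Empirical

variable {d n : ℕ}

open scoped Classical in
theorem empirical_apply (X : Fin n → Fin d → ℝ) {s : Set (Fin d → ℝ)} (hs : MeasurableSet s) :
    empirical X s = ((Finset.univ.filter fun i => X i ∈ s).card : ℝ≥0∞) / n := by
  simp only [empirical, Measure.smul_apply, Measure.finsetSum_apply, smul_eq_mul,
    Measure.dirac_apply' _ hs, Set.indicator_apply, Pi.one_apply, Finset.sum_boole]
  rw [mul_comm, div_eq_mul_inv]

theorem isProbabilityMeasure_empirical (hn : 0 < n) (X : Fin n → Fin d → ℝ) :
    IsProbabilityMeasure (empirical X) := by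
  constructor
  rw [empirical_apply X MeasurableSet.univ]
  simp only [Set.mem_univ, Finset.filter_true, Finset.card_univ, Fintype.card_fin]
  exact ENNReal.div_self (by exact_mod_cast hn.ne') (ENNReal.natCast_ne_top n)

theorem ae_empirical {X : Fin n → Fin d → ℝ} {p : (Fin d → ℝ) → Prop}
    (hp : MeasurableSet {x | p x}) (h : ∀ i, p (X i)) : ∀ᵐ x ∂empirical X, p x := by
  classical
  rw [ae_iff]
  have := empirical_apply X hp.compl
  rw [show {x | p x}ᶜ = {x | ¬ p x} from rfl] at this
  simp [this, h]

theorem empirical_mem_probOnBall {N : Seminorm ℝ (Fin d → ℝ)} {r : ℝ} (hn : 0 < n)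
    {X : Fin n → Fin d → ℝ} (h : ∀ i, N (X i) ≤ r) : empirical X ∈ probOnBall N r :=
  ⟨isProbabilityMeasure_empirical hn X,
    ae_empirical (isClosed_le N.continuous_pi continuous_const).measurableSet h⟩

/-- Two uniform measures on `n` points, each chosen in one of `n` pairs of `η`-separated points,
are at Wasserstein distance at least `η` times the proportion of differing choices. -/
theorem le_wasserstein_empirical {N : Seminorm ℝ (Fin d → ℝ)} {q η : ℝ} (hq : 1 ≤ q) (hη : 0 < η)
    (hn : 0 < n) {x : Fin n → Bool → Fin d → ℝ}
    (hx : ∀ i b j c, (i, b) ≠ (j, c) → η < N (x i b - x j c)) (σ τ : Fin n → Bool) :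
    ENNReal.ofReal η * ((hammingDist σ τ : ℝ≥0∞) / n) ≤
      wasserstein N q (empirical fun i => x i (σ i)) (empirical fun i => x i (τ i)) := by
  classical
  have hq0 : 0 < q := by linarith
  have hn0 : (n : ℝ≥0∞) ≠ 0 := by exact_mod_cast hn.ne'
  refine le_wasserstein hq fun π h₁ h₂ => ?_
  set S := Set.range fun i => x i (σ i) with hS
  set T := Set.range fun i => x i (τ i) with hT
  have hSm : MeasurableSet S := (Set.finite_range _).measurableSet
  have hTm : MeasurableSet T := (Set.finite_range _).measurableSet
  have e₁ : ∀ᵐ z ∂π, z.1 ∈ S := by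
    have := ae_empirical (X := fun i => x i (σ i)) (p := (· ∈ S)) hSm fun i => ⟨i, rfl⟩
    rw [← h₁] at this
    exact ae_of_ae_map measurable_fst.aemeasurable this
  have e₂ : ∀ᵐ z ∂π, z.2 ∈ T := by
    have := ae_empirical (X := fun i => x i (τ i)) (p := (· ∈ T)) hTm fun i => ⟨i, rfl⟩
    rw [← h₂] at this
    exact ae_of_ae_map measurable_snd.aemeasurable this
  -- Where the choices differ, the point of the first measure is not an atom of the second, so its
  -- mass must travel farther than `η`.
  have hA : MeasurableSet (Prod.fst ⁻¹' Tᶜ : Set ((Fin d → ℝ) × (Fin d → ℝ))) :=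
    measurable_fst hTm.compl
  have hπ : ((hammingDist σ τ : ℝ≥0∞) / n) ≤ π (Prod.fst ⁻¹' Tᶜ) := by
    rw [← Measure.map_apply measurable_fst hTm.compl, h₁, empirical_apply _ hTm.compl]
    gcongr
    refine Finset.card_le_card fun i hi => ?_
    simp only [Finset.mem_filter, Finset.mem_univ, true_and] at hi ⊢
    rintro ⟨j, hj⟩
    have hij := hx i (σ i) j (τ j) fun h => by
      rw [Prod.mk.injEq] at h
      obtain ⟨rfl, h⟩ := h
      exact hi h
    rw [show x j (τ j) = x i (σ i) from hj, sub_self, map_zero] at hij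
    exact hη.not_gt hij
  have hint : ENNReal.ofReal (η ^ q) * ((hammingDist σ τ : ℝ≥0∞) / n) ≤
      ∫⁻ z, ENNReal.ofReal (N (z.1 - z.2) ^ q) ∂π := by
    calc _ ≤ ENNReal.ofReal (η ^ q) * π (Prod.fst ⁻¹' Tᶜ) := by gcongr
      _ = ∫⁻ z, (Prod.fst ⁻¹' Tᶜ).indicator (fun _ => ENNReal.ofReal (η ^ q)) z ∂π :=
        (lintegral_indicator_const hA _).symm
      _ ≤ _ := by
        refine lintegral_mono_ae ?_
        filter_upwards [e₁, e₂] with z hz₁ hz₂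
        by_cases hz : z ∈ (Prod.fst ⁻¹' Tᶜ : Set ((Fin d → ℝ) × (Fin d → ℝ)))
        · rw [Set.indicator_of_mem hz]
          obtain ⟨i, hi⟩ := hz₁
          obtain ⟨j, hj⟩ := hz₂
          have hij := hx i (σ i) j (τ j) fun h => by
            rw [Prod.mk.injEq] at h
            obtain ⟨rfl, h⟩ := h
            exact hz ⟨i, by rw [← hi]; simp only [h]⟩
          rw [← hi, ← hj]
          exact ENNReal.ofReal_le_ofReal (Real.rpow_le_rpow hη.le hij.le hq0.le)
        · rw [Set.indicator_of_notMem hz]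
          exact zero_le
  have hle1 : (hammingDist σ τ : ℝ≥0∞) / n ≤ 1 := by
    refine ENNReal.div_le_of_le_mul ?_
    rw [one_mul]
    exact_mod_cast hammingDist_le_card_fintype.trans_eq (Fintype.card_fin n)
  calc ENNReal.ofReal η * ((hammingDist σ τ : ℝ≥0∞) / n)
      -- A proportion is at most `1`, so taking the `q`-th root can only increase it.
      ≤ ENNReal.ofReal η * ((hammingDist σ τ : ℝ≥0∞) / n) ^ (1 / q) := by
        gcongr
        conv_lhs => rw [← ENNReal.rpow_one ((hammingDist σ τ : ℝ≥0∞) / n)]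
        exact ENNReal.rpow_le_rpow_of_exponent_ge hle1 ((div_le_one hq0).2 hq)
    _ = (ENNReal.ofReal (η ^ q) * ((hammingDist σ τ : ℝ≥0∞) / n)) ^ (1 / q) := by
        rw [ENNReal.mul_rpow_of_nonneg _ _ (by positivity), ← ENNReal.ofReal_rpow_of_pos hη,
          one_div, ENNReal.rpow_rpow_inv hq0.ne']
    _ ≤ _ := ENNReal.rpow_le_rpow hint (by positivity)

end Empirical

/-! ### Lower bound for the size of a maximal family -/

section Packing

theorem sum_pow_hammingDist {n : ℕ} (σ : Fin n → Bool) (s : ℝ) :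
    ∑ τ : Fin n → Bool, s ^ hammingDist τ σ = (1 + s) ^ n := by
  have h : ∀ τ : Fin n → Bool, s ^ hammingDist τ σ = ∏ i, if τ i ≠ σ i then s else 1 := by
    intro τ
    rw [Finset.prod_ite, Finset.prod_const, Finset.prod_const_one, mul_one]
    rfl
  simp_rw [h]
  rw [← Fintype.piFinset_univ, ← Finset.prod_univ_sum (fun _ => Finset.univ)
    (fun i b => if b ≠ σ i then s else 1)]
  have h' : ∀ i, ∑ b, (if b ≠ σ i then s else 1) = 1 + s := by
    intro i
    rw [Fintype.sum_bool]
    cases σ i <;> simp [add_comm]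
  rw [Finset.prod_congr rfl fun i _ => h' i, Finset.prod_const, Finset.card_univ, Fintype.card_fin]

/-- A Hamming ball of radius `n / 8` of the cube `{0, 1}ⁿ` has at most `(3/2)ⁿ` elements. -/
theorem card_hammingBall_le {n : ℕ} (σ : Fin n → Bool) :
    ((Finset.univ.filter fun τ : Fin n → Bool => 8 * hammingDist τ σ ≤ n).card : ℝ)
      ≤ (3 / 2) ^ n := by
  -- Chernoff bound with parameter `s = (4/5)^8`: each point of the ball contributes at least
  -- `(4/5)^n` to `(1 + s)^n`, and `1 + s ≤ (3/2) (4/5)`.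
  have h : ∀ τ ∈ Finset.univ.filter fun τ : Fin n → Bool => 8 * hammingDist τ σ ≤ n,
      (4 / 5 : ℝ) ^ n ≤ ((4 / 5 : ℝ) ^ 8) ^ hammingDist τ σ := by
    intro τ hτ
    rw [← pow_mul]
    exact pow_le_pow_of_le_one (by norm_num) (by norm_num) (Finset.mem_filter.1 hτ).2
  have h₁ := Finset.card_nsmul_le_sum _ _ _ h
  have h₂ := h₁.trans (Finset.sum_le_univ_sum_of_nonneg fun τ => by positivity)
  rw [sum_pow_hammingDist, nsmul_eq_mul] at h₂
  rw [← mul_le_mul_iff_left₀ (show (0 : ℝ) < (4 / 5) ^ n by positivity), ← mul_pow]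
  exact h₂.trans (pow_le_pow_left₀ (by norm_num) (by norm_num) n)

variable {d k : ℕ} {N : Seminorm ℝ (Fin d → ℝ)} {q r δ : ℝ}

/-- A maximal separated family is a net: a tuple far from every member could be added to it. -/
theorem IsMaximalDistinct.exists_near (hq : 1 ≤ q) {F : Set (Fin k → Measure (Fin d → ℝ))}
    (hF : IsMaximalDistinct N q r δ F) {Y : Fin k → Measure (Fin d → ℝ)}
    (hY : Y ∈ outputs N r k) :
    ∃ Z ∈ F, ∀ i, wasserstein N q (Y i) (Z i) ≤ ENNReal.ofReal δ := by
  by_cases hYF : Y ∈ F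
  · exact ⟨Y, hYF, fun i => by rw [wasserstein_self hq]; exact zero_le⟩
  by_contra! H
  refine hYF (hF.2 (y := insert Y F) ⟨Set.insert_subset hY hF.1.1, ?_⟩ (Set.subset_insert Y F)
    (Set.mem_insert Y F))
  refine hF.1.2.insert fun Z hZ _ => ⟨H Z hZ, ?_⟩
  obtain ⟨i, hi⟩ := H Z hZ
  exact ⟨i, by rwa [wasserstein_comm hq]⟩

theorem outputs_nonempty (hr : 0 < r) : (outputs N r k).Nonempty :=
  ⟨fun _ => empirical fun _ : Fin 1 => 0,
    fun _ => empirical_mem_probOnBall one_pos fun _ => by simpa using hr.le⟩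

theorem IsMaximalDistinct.nonempty (hq : 1 ≤ q) (hr : 0 < r)
    {F : Set (Fin k → Measure (Fin d → ℝ))} (hF : IsMaximalDistinct N q r δ F) : F.Nonempty := by
  obtain ⟨Y, hY⟩ := outputs_nonempty (N := N) (k := k) hr
  obtain ⟨Z, hZ, -⟩ := hF.exists_near hq hY
  exact ⟨Z, hZ⟩

/-- Send each of the `2^(n k)` choices to a nearby member of `F`. Two choices with the same image
are within `2δ`, so in each component they differ in at most a proportion `2δ / (16δ) = 1/8` of the
places. Fibres thus have at most `(3/2)^(n k)` elements. -/
theorem IsMaximalDistinct.pow_le_ncard_of_points (hq : 1 ≤ q) (hδ : 0 < δ)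
    {F : Set (Fin k → Measure (Fin d → ℝ))} (hF : IsMaximalDistinct N q r δ F) (hfin : F.Finite)
    {n : ℕ} (hn : 0 < n) {x : Fin n → Bool → Fin d → ℝ} (hxr : ∀ i b, N (x i b) ≤ r)
    (hx : ∀ i b j c, (i, b) ≠ (j, c) → 16 * δ < N (x i b - x j c)) :
    (4 / 3 : ℝ) ^ (n * k) ≤ F.ncard := by
  classical
  have hmem : ∀ σ : Fin n → Bool, (empirical fun i => x i (σ i)) ∈ probOnBall N r := fun σ =>
    empirical_mem_probOnBall hn fun i => hxr i _
  choose φ hφF hφ using fun σ : Fin k → Fin n → Bool =>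
    hF.exists_near hq (Y := fun l => empirical fun i => x i (σ l i)) fun l => hmem (σ l)
  have hham : ∀ σ τ, φ σ = φ τ → ∀ l, 8 * hammingDist (σ l) (τ l) ≤ n := by
    intro σ τ hst l
    have := (hmem (σ l)).1
    have h₁ := (le_wasserstein_empirical hq (by positivity) hn hx (σ l) (τ l)).trans
      (wasserstein_triangle hq _ (φ σ l) _)
    have h₂ := hφ τ l
    rw [wasserstein_comm hq, ← hst] at h₂
    have h₃ := h₁.trans (add_le_add (hφ σ l) h₂)
    rw [← ENNReal.ofReal_add hδ.le hδ.le, ← ENNReal.ofReal_natCast, ← ENNReal.ofReal_natCast,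
      ← ENNReal.ofReal_div_of_pos (by exact_mod_cast hn), ← ENNReal.ofReal_mul (by positivity),
      ENNReal.ofReal_le_ofReal_iff (by positivity), mul_div_assoc',
      div_le_iff₀ (by exact_mod_cast hn)] at h₃
    have h₄ : (8 * hammingDist (σ l) (τ l) : ℝ) ≤ n := by nlinarith
    exact_mod_cast h₄
  have hfib : ∀ Z ∈ hfin.toFinset, ((Finset.univ.filter fun σ => φ σ = Z).card : ℝ) ≤
      ((3 / 2) ^ n) ^ k := by
    intro Z _
    rcases (Finset.univ.filter fun σ => φ σ = Z).eq_empty_or_nonempty with h | ⟨σ, hσ⟩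
    · rw [h]; simp only [Finset.card_empty, Nat.cast_zero]; positivity
    · have hsub : (Finset.univ.filter fun τ => φ τ = Z) ⊆ Fintype.piFinset fun l =>
          Finset.univ.filter fun τ : Fin n → Bool => 8 * hammingDist τ (σ l) ≤ n := by
        intro τ hτ
        rw [Fintype.mem_piFinset]
        intro l
        rw [Finset.mem_filter] at hσ hτ ⊢
        exact ⟨Finset.mem_univ _, hham τ σ (hτ.2.trans hσ.2.symm) l⟩
      calc ((Finset.univ.filter fun τ => φ τ = Z).card : ℝ) ≤ _ :=
            Nat.cast_le.2 (Finset.card_le_card hsub)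
        _ ≤ ∏ _l : Fin k, ((3 / 2 : ℝ) ^ n) := by
            rw [Fintype.card_piFinset, Nat.cast_prod]
            exact Finset.prod_le_prod (fun _ _ => Nat.cast_nonneg _)
              fun l _ => card_hammingBall_le (σ l)
        _ = _ := by simp
  have hcard : ((2 : ℝ) ^ n) ^ k ≤ F.ncard * ((3 / 2) ^ n) ^ k := by
    have h₁ := Finset.card_eq_sum_card_fiberwise (s := Finset.univ) (f := φ)
      (t := hfin.toFinset) fun σ _ => by simpa using hφF σ
    have h₂ : (Finset.univ : Finset (Fin k → Fin n → Bool)).card = (2 ^ n) ^ k := by simp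
    rw [h₂] at h₁
    have h₃ : ((2 : ℝ) ^ n) ^ k =
        ∑ Z ∈ hfin.toFinset, ((Finset.univ.filter fun σ => φ σ = Z).card : ℝ) := by
      exact_mod_cast h₁
    rw [h₃, Set.ncard_eq_toFinset_card F hfin, ← nsmul_eq_mul]
    exact Finset.sum_le_card_nsmul _ _ _ hfib
  rw [← mul_le_mul_iff_left₀ (show (0 : ℝ) < ((3 / 2) ^ n) ^ k by positivity), pow_mul, ← mul_pow,
    ← mul_pow]
  norm_num at hcard ⊢
  exact hcard

theorem IsMaximalDistinct.pow_le_ncard (hN : ∀ x, N x = 0 → x = 0) (hq : 1 ≤ q) (hr : 0 < r)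
    (hδ : 0 < δ) {F : Set (Fin k → Measure (Fin d → ℝ))} (hF : IsMaximalDistinct N q r δ F)
    (hfin : F.Finite) {n : ℕ} (hn : 0 < n) (hnr : 2 * (n : ℝ) ≤ (r / (16 * δ)) ^ d) :
    (4 / 3 : ℝ) ^ (n * k) ≤ F.ncard := by
  obtain ⟨S, hS, -, -, hcard⟩ := exists_separated_net hN hr (show 0 < 16 * δ by positivity)
  have hle : Fintype.card (Fin n × Bool) ≤ Fintype.card S := by
    simp only [Fintype.card_prod, Fintype.card_fin, Fintype.card_bool, Fintype.card_coe]
    rw [mul_comm]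
    exact_mod_cast hnr.trans hcard
  obtain ⟨e⟩ := Function.Embedding.nonempty_of_card_le hle
  exact hF.pow_le_ncard_of_points hq hδ hfin hn (x := fun i b => e (i, b))
    (fun i b => hS.1 _ (e (i, b)).2) fun i b j c hne =>
      hS.2 _ (e (i, b)).2 _ (e (j, c)).2 fun h => hne (e.injective (Subtype.ext h))

end Packing

/-! ### Discretization of measures and of pre-prompts -/

section Discretization

variable {d k m n M : ℕ} {N : Seminorm ℝ (Fin d → ℝ)} {q r a c L ε δ : ℝ}

/-- Disjoint measurable sets of `N`-diameter at most `a` that cover the ball of radius `r`. -/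
structure IsCellCover (N : Seminorm ℝ (Fin d → ℝ)) (r a : ℝ) (C : Fin n → Set (Fin d → ℝ)) :
    Prop where
  measurableSet : ∀ j, MeasurableSet (C j)
  disjoint : Pairwise (Function.onFun Disjoint C)
  cover : ∀ x, N x ≤ r → ∃ j, x ∈ C j
  diam_le : ∀ j, ∀ x ∈ C j, ∀ y ∈ C j, N (x - y) ≤ a

theorem IsCellCover.sum_measureReal {C : Fin n → Set (Fin d → ℝ)} (hC : IsCellCover N r a C)
    {μ : Measure (Fin d → ℝ)} (hμ : μ ∈ probOnBall N r) : ∑ j, μ.real (C j) = 1 := by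
  have := hμ.1
  have h := Measure.eq_sum_inter hC.measurableSet hC.disjoint
    (hμ.2.mono fun x hx => hC.cover x hx) MeasurableSet.univ
  simp only [measure_univ, Set.univ_inter] at h
  simp only [Measure.real]
  rw [← ENNReal.toReal_sum fun j _ => measure_ne_top μ _, ← h, ENNReal.toReal_one]

theorem IsCellCover.wasserstein_le {C : Fin n → Set (Fin d → ℝ)} (hC : IsCellCover N r a C)
    (hq : 1 ≤ q) (hr : 0 ≤ r) (ha : 0 ≤ a) (hc : 0 ≤ c) {t : ℝ}
    (hact : a ^ q + (2 * r) ^ q * t ≤ c ^ q) {μ ν : Measure (Fin d → ℝ)}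
    (hμ : μ ∈ probOnBall N r) (hν : ν ∈ probOnBall N r) {w : Fin n → ℝ} (hw0 : ∀ j, 0 ≤ w j)
    (hwμ : ∀ j, w j ≤ μ.real (C j)) (hwν : ∀ j, w j ≤ ν.real (C j)) (hw : 1 - t ≤ ∑ j, w j) :
    wasserstein N q μ ν ≤ ENNReal.ofReal c := by
  have hq0 : 0 < q := by linarith
  have := hμ.1
  have := hν.1
  refine (wasserstein_le_of_cells hq hμ hν hC.measurableSet hC.disjoint hC.cover hC.diam_le
    (w := fun j => ENNReal.ofReal (w j))
    (fun j => (ENNReal.ofReal_le_iff_le_toReal (measure_ne_top _ _)).2 (hwμ j))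
    (fun j => (ENNReal.ofReal_le_iff_le_toReal (measure_ne_top _ _)).2 (hwν j))).trans ?_
  have hs : ∑ j, w j ≤ 1 := by
    rw [← hC.sum_measureReal hμ]
    exact Finset.sum_le_sum fun j _ => hwμ j
  rw [← ENNReal.ofReal_sum_of_nonneg fun j _ => hw0 j, ← ENNReal.ofReal_one,
    ← ENNReal.ofReal_sub _ (Finset.sum_nonneg fun j _ => hw0 j),
    ← ENNReal.ofReal_mul (by positivity),
    ← ENNReal.ofReal_add (by positivity) (mul_nonneg (by positivity) (by linarith)),
    one_div, ENNReal.rpow_inv_le_iff hq0, ENNReal.ofReal_rpow_of_nonneg hc hq0.le]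
  refine ENNReal.ofReal_le_ofReal (le_trans ?_ hact)
  gcongr
  linarith

theorem sum_floor_div_ge (hM : 0 < M) (f : Fin n → ℝ) :
    ∑ j, f j - n / M ≤ ∑ j, (⌊M * f j⌋₊ : ℝ) / M := by
  have hM' : (0 : ℝ) < M := by exact_mod_cast hM
  have h : ∀ j, f j - 1 / M ≤ (⌊M * f j⌋₊ : ℝ) / M := by
    intro j
    rw [le_div_iff₀ hM', sub_mul, one_div_mul_cancel hM'.ne']
    linarith [Nat.lt_floor_add_one (M * f j), mul_comm (f j) M]
  refine le_trans (le_of_eq ?_) (Finset.sum_le_sum fun j _ => h j)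
  simp [Finset.sum_sub_distrib, div_eq_mul_inv]

theorem floor_div_le (hM : 0 < M) {x : ℝ} (hx : 0 ≤ x) : (⌊M * x⌋₊ : ℝ) / M ≤ x := by
  have hM' : (0 : ℝ) < M := by exact_mod_cast hM
  rw [div_le_iff₀ hM', mul_comm x]
  exact Nat.floor_le (by positivity)

theorem rpow_half_le (hq : 1 ≤ q) (hc : 0 ≤ c) : (c / 2) ^ q ≤ c ^ q / 2 := by
  rw [Real.div_rpow hc (by norm_num)]
  have : (2 : ℝ) ≤ 2 ^ q := by
    conv_lhs => rw [← Real.rpow_one 2]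
    exact Real.rpow_le_rpow_of_exponent_le (by norm_num) hq
  gcongr

theorem exists_isCellCover (hN : ∀ x, N x = 0 → x = 0) (hr : 0 < r) (ha : 0 < a) :
    ∃ (n : ℕ) (C : Fin n → Set (Fin d → ℝ)), 0 < n ∧ (n : ℝ) ≤ (1 + 4 * r / a) ^ d ∧
      IsCellCover N r a C := by
  obtain ⟨n, C, hn, hle, h₁, h₂, h₃, h₄⟩ := exists_cells hN hr ha
  exact ⟨n, C, hn, hle, h₁, h₂, h₃, h₄⟩

/-- Half of `c ^ q` pays for moves inside cells, half for the mass, at most `n / M`, lost by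
rounding. -/
theorem cost_budget (hq : 1 ≤ q) (hr : 0 < r) (hc : 0 < c) (hM : 0 < M)
    (h : 2 * (n : ℝ) * (2 * r / c) ^ q ≤ M) :
    (c / 2) ^ q + (2 * r) ^ q * ((n : ℝ) / M) ≤ c ^ q := by
  have hM' : (0 : ℝ) < M := by exact_mod_cast hM
  have h₁ : (2 * r) ^ q * ((n : ℝ) / M) ≤ c ^ q / 2 := by
    rw [Real.div_rpow (by positivity) hc.le, mul_div_assoc', div_le_iff₀ (by positivity)] at h
    rw [mul_div_assoc', div_le_iff₀ hM']
    linarith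
  linarith [rpow_half_le hq hc.le]

/-- Rounded cell masses take finitely many values, and tuples sharing them are within `δ`, hence
equal in `F`. -/
theorem IsMaximalDistinct.finite (hN : ∀ x, N x = 0 → x = 0) (hq : 1 ≤ q) (hr : 0 < r)
    (hδ : 0 < δ) {F : Set (Fin k → Measure (Fin d → ℝ))} (hF : IsMaximalDistinct N q r δ F) :
    F.Finite := by
  obtain ⟨n, C, hn, -, hC⟩ := exists_isCellCover hN hr (half_pos hδ)
  obtain ⟨M, hM⟩ := exists_nat_ge (2 * (n : ℝ) * (2 * r / δ) ^ q)
  have hM0 : 0 < M := by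
    have : (0 : ℝ) < M := lt_of_lt_of_le (by positivity) hM
    exact_mod_cast this
  have hM' : (0 : ℝ) < M := by exact_mod_cast hM0
  let f : (Fin k → Measure (Fin d → ℝ)) → Fin k → Fin n → ℕ := fun Y i j => ⌊M * (Y i).real (C j)⌋₊
  refine Set.Finite.of_injOn (f := f) (t := Set.Iic fun _ _ => M) ?_ ?_ (Set.finite_Iic _)
  · intro Y hY i j
    have := (hF.1.1 hY i).1
    exact Nat.floor_le_of_le (mul_le_of_le_one_right hM'.le measureReal_le_one)
  · intro Y hY Z hZ hYZ
    by_contra hne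
    obtain ⟨i, hi⟩ := hF.1.2 hY hZ hne
    refine absurd hi (not_lt.2 ?_)
    have e : ∀ j, ⌊M * (Y i).real (C j)⌋₊ = ⌊M * (Z i).real (C j)⌋₊ := fun j =>
      congrFun (congrFun hYZ i) j
    refine hC.wasserstein_le hq hr.le (by positivity) hδ.le (cost_budget hq hr hδ hM0 hM)
      (hF.1.1 hY i) (hF.1.1 hZ i) (w := fun j => (⌊M * (Y i).real (C j)⌋₊ : ℝ) / M)
      (fun j => by positivity) (fun j => floor_div_le hM0 measureReal_nonneg) (fun j => ?_) ?_
    · simp only [e j]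
      exact floor_div_le hM0 measureReal_nonneg
    · rw [← hC.sum_measureReal (hF.1.1 hY i)]
      exact sum_floor_div_ge hM0 _

open scoped Classical in
/-- The mass given to the set `s` by the tokens of the pre-prompt `P`, in a sequence that has `m`
further tokens. -/
noncomputable def promptMass (m : ℕ) {p : ℕ} (P : Fin p → Fin d → ℝ) (s : Set (Fin d → ℝ)) : ℝ :=
  ((Finset.univ.filter fun i => P i ∈ s).card : ℝ) * (1 / ((p : ℝ) + m))

theorem promptMass_nonneg {p : ℕ} (P : Fin p → Fin d → ℝ) (s : Set (Fin d → ℝ)) :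
    0 ≤ promptMass m P s := by
  unfold promptMass; positivity

theorem promptMass_le_one {p : ℕ} (P : Fin p → Fin d → ℝ) (s : Set (Fin d → ℝ)) :
    promptMass m P s ≤ 1 := by
  classical
  unfold promptMass
  rw [mul_one_div]
  refine div_le_one_of_le₀ ?_ (by positivity)
  have : ((Finset.univ.filter fun i => P i ∈ s).card : ℝ) ≤ p := by
    exact_mod_cast (Finset.card_le_univ _).trans_eq (Fintype.card_fin p)
  linarith [(Nat.cast_nonneg m : (0 : ℝ) ≤ m)]

open scoped Classical in
theorem empirical_append_real {p : ℕ} (P : Fin p → Fin d → ℝ) (X : Fin m → Fin d → ℝ)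
    {s : Set (Fin d → ℝ)} (hs : MeasurableSet s) :
    (empirical (Fin.append P X)).real s =
      promptMass m P s + ((Finset.univ.filter fun i => X i ∈ s).card : ℝ) * (1 / ((p : ℝ) + m)) := by
  rw [Measure.real, empirical_apply _ hs, ENNReal.toReal_div, promptMass]
  simp only [Finset.card_filter, Fin.sum_univ_add, Fin.append_left, Fin.append_right]
  simp only [ENNReal.toReal_natCast]
  push_cast
  ring

theorem append_mem_probOnBall {p : ℕ} (hm : 0 < m) {P : Fin p → Fin d → ℝ}
    (hP : ∀ i, N (P i) ≤ r) {X : Fin m → Fin d → ℝ} (hX : ∀ i, N (X i) ≤ r) :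
    empirical (Fin.append P X) ∈ probOnBall N r :=
  empirical_mem_probOnBall (by omega) fun i => by
    refine Fin.addCases (fun i => ?_) (fun i => ?_) i
    · rw [Fin.append_left]; exact hP i
    · rw [Fin.append_right]; exact hX i

/-- Two pre-prompts whose token masses in the cells have the same integer parts lead to close
empirical measures, whatever the input. -/
theorem IsCellCover.wasserstein_append_le {C : Fin n → Set (Fin d → ℝ)} (hC : IsCellCover N r a C)
    (hq : 1 ≤ q) (hr : 0 ≤ r) (ha : 0 ≤ a) (hc : 0 ≤ c) (hM : 0 < M)
    (hact : a ^ q + (2 * r) ^ q * ((n : ℝ) / M) ≤ c ^ q) (hm : 0 < m) {X : Fin m → Fin d → ℝ}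
    (hX : ∀ i, N (X i) ≤ r) {p p' : ℕ} {P : Fin p → Fin d → ℝ} {P' : Fin p' → Fin d → ℝ}
    (hP : ∀ i, N (P i) ≤ r) (hP' : ∀ i, N (P' i) ≤ r)
    (h : ∀ j, ⌊M * promptMass m P (C j)⌋₊ = ⌊M * promptMass m P' (C j)⌋₊) :
    wasserstein N q (empirical (Fin.append P X)) (empirical (Fin.append P' X)) ≤
      ENNReal.ofReal c := by
  classical
  have hμ := append_mem_probOnBall hm hP hX
  have hν := append_mem_probOnBall hm hP' hX
  let κ : Fin n → ℝ := fun j => ((Finset.univ.filter fun i => X i ∈ C j).card : ℝ)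
  have hκ : ∀ j, 0 ≤ κ j := fun j => Nat.cast_nonneg _
  -- An input token weighs `1 / (p + m)` in one measure and `1 / (p' + m)` in the other; the smaller
  -- weight is common to both.
  set u : ℝ := min (1 / ((p : ℝ) + m)) (1 / ((p' : ℝ) + m)) with hu
  have hu0 : 0 ≤ u := le_min (by positivity) (by positivity)
  refine hC.wasserstein_le hq hr ha hc hact hμ hν
    (w := fun j => (⌊M * promptMass m P (C j)⌋₊ : ℝ) / M + κ j * u)
    (fun j => add_nonneg (by positivity) (mul_nonneg (hκ j) hu0)) (fun j => ?_) (fun j => ?_) ?_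
  · rw [empirical_append_real _ _ (hC.measurableSet j)]
    exact add_le_add (floor_div_le hM (promptMass_nonneg _ _))
      (mul_le_mul_of_nonneg_left (min_le_left _ _) (hκ j))
  · rw [empirical_append_real _ _ (hC.measurableSet j)]
    simp only [h j]
    exact add_le_add (floor_div_le hM (promptMass_nonneg _ _))
      (mul_le_mul_of_nonneg_left (min_le_right _ _) (hκ j))
  · rw [Finset.sum_add_distrib]
    -- In the measure that attains the minimum the input mass is kept exactly, so only rounding the
    -- prompt masses loses anything, at most `n / M` in all. The lengths therefore need not be
    -- recorded.
    rcases min_choice (1 / ((p : ℝ) + m)) (1 / ((p' : ℝ) + m)) with h' | h'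
    · have h₁ := sum_floor_div_ge hM fun j => promptMass m P (C j)
      have h₂ := hC.sum_measureReal hμ
      simp only [empirical_append_real _ _ (hC.measurableSet _), Finset.sum_add_distrib] at h₂
      rw [hu, h']
      linarith
    · have h₁ := sum_floor_div_ge hM fun j => promptMass m P' (C j)
      have h₂ := hC.sum_measureReal hν
      simp only [empirical_append_real _ _ (hC.measurableSet _), Finset.sum_add_distrib] at h₂
      simp only [h]
      rw [hu, h']
      linarith

/-- If the pre-prompts fall into finitely many classes such that pre-prompts of the same class
lead to `ε / L`-close empirical measures, there are no more accessible outputs than classes. -/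
theorem ncard_accessible_le {τ : Transformer d} (hq : 1 ≤ q) (hL : 0 < L) (hε : 0 < ε)
    (hτ : τ.MeanFieldLipschitz N q r L) (hm : 0 < m) {X : Fin k → Fin m → Fin d → ℝ}
    (hX : ∀ i j, N (X i j) ≤ r) {F : Set (Fin k → Measure (Fin d → ℝ))} (hFr : F ⊆ outputs N r k)
    (hF : F.Pairwise (Distinct N q (3 * ε))) {β : Type*} [Finite β]
    (g : (p : ℕ) → (Fin p → Fin d → ℝ) → β)
    (hg : ∀ p p' (P : Fin p → Fin d → ℝ) (P' : Fin p' → Fin d → ℝ), (∀ j, N (P j) ≤ r) →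
      (∀ j, N (P' j) ≤ r) → g p P = g p' P' → ∀ i,
      wasserstein N q (empirical (Fin.append P (X i))) (empirical (Fin.append P' (X i))) ≤
        ENNReal.ofReal (ε / L)) :
    {Y ∈ F | τ.Accessible N q r ε X Y}.ncard ≤ Nat.card β := by
  classical
  rw [← Set.ncard_univ]
  have hacc : ∀ Y, ∃ (p : ℕ) (P : Fin p → Fin d → ℝ), τ.Accessible N q r ε X Y →
      (∀ j, N (P j) ≤ r) ∧ ∀ i, wasserstein N q
        (τ.meanField (empirical (Fin.append P (X i)))) (Y i) ≤ ENNReal.ofReal ε := by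
    intro Y
    by_cases hY : τ.Accessible N q r ε X Y
    · obtain ⟨p, P, h⟩ := hY
      exact ⟨p, P, fun _ => h⟩
    · exact ⟨0, Fin.elim0, fun h => absurd h hY⟩
  choose p P hP using hacc
  refine Set.ncard_le_ncard_of_injOn (fun Y => g (p Y) (P Y)) (fun _ _ => Set.mem_univ _) ?_
  rintro Y ⟨hYF, hY⟩ Z ⟨hZF, hZ⟩ hYZ
  by_contra hne
  obtain ⟨i, hi⟩ := hF hYF hZF hne
  refine absurd hi (not_lt.2 ?_)
  have := (hFr hYF i).1
  have h₁ := (hP Y hY).2 i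
  have h₂ := (hP Z hZ).2 i
  have h₃ : wasserstein N q (τ.meanField (empirical (Fin.append (P Y) (X i))))
      (τ.meanField (empirical (Fin.append (P Z) (X i)))) ≤ ENNReal.ofReal ε := by
    refine (hτ _ (append_mem_probOnBall hm (hP Y hY).1 (hX i)) _
      (append_mem_probOnBall hm (hP Z hZ).1 (hX i))).trans ?_
    calc _ ≤ ENNReal.ofReal L * ENNReal.ofReal (ε / L) := by
          gcongr
          exact hg _ _ _ _ (hP Y hY).1 (hP Z hZ).1 hYZ i
      _ = ENNReal.ofReal ε := by
          rw [← ENNReal.ofReal_mul hL.le, mul_div_cancel₀ _ hL.ne']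
  rw [wasserstein_comm hq] at h₁
  -- The resolution `3ε`: one `ε` at each output, and one between the two transformed measures.
  calc wasserstein N q (Y i) (Z i)
      ≤ wasserstein N q (Y i) (τ.meanField (empirical (Fin.append (P Z) (X i)))) +
          wasserstein N q (τ.meanField (empirical (Fin.append (P Z) (X i)))) (Z i) :=
        wasserstein_triangle hq _ _ _
    _ ≤ (ENNReal.ofReal ε + ENNReal.ofReal ε) + ENNReal.ofReal ε :=
        add_le_add ((wasserstein_triangle hq _ _ _).trans (add_le_add h₁ h₃)) h₂
    _ = ENNReal.ofReal (3 * ε) := by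
        rw [← ENNReal.ofReal_add hε.le hε.le, ← ENNReal.ofReal_add (by positivity) hε.le]
        congr 1; ring

theorem wasserstein_le_diam (hq : 1 ≤ q) (hr : 0 < r) {μ ν : Measure (Fin d → ℝ)}
    (hμ : μ ∈ probOnBall N r) (hν : ν ∈ probOnBall N r) :
    wasserstein N q μ ν ≤ ENNReal.ofReal (2 * r) := by
  have hC : IsCellCover N r (2 * r) fun _ : Fin 1 => {x | N (x - 0) ≤ r} := by
    refine ⟨fun _ => N.measurableSet_le 0 r, fun i j hij => absurd (Subsingleton.elim i j) hij,
      fun x hx => ⟨0, by simpa using hx⟩, fun _ x hx y hy => ?_⟩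
    simp only [sub_zero, Set.mem_ofPred_eq] at hx hy
    linarith [map_sub_le_add N x y]
  have h₁ := hC.sum_measureReal hμ
  have h₂ := hC.sum_measureReal hν
  simp only [Fin.sum_univ_one] at h₁ h₂
  exact hC.wasserstein_le hq hr.le (by positivity) (by positivity) (t := 0) (by simp) hμ hν
    (w := fun _ => 1) (fun _ => zero_le_one) (fun _ => h₁.ge) (fun _ => h₂.ge) (by simp)

/-- Here the whole ball has diameter at most `ε / L`. Treated apart because `logNumerator` may be
close to `0`, too small for a count with at least one cell. -/
theorem ncard_accessible_le_one {τ : Transformer d} (hq : 1 ≤ q) (hr : 0 < r) (hL : 0 < L)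
    (hε : 0 < ε) (hLr : 2 * (L * r / ε) ≤ 1)
    (hτ : τ.MeanFieldLipschitz N q r L) (hm : 0 < m) {X : Fin k → Fin m → Fin d → ℝ}
    (hX : ∀ i j, N (X i j) ≤ r) {F : Set (Fin k → Measure (Fin d → ℝ))} (hFr : F ⊆ outputs N r k)
    (hF : F.Pairwise (Distinct N q (3 * ε))) :
    {Y ∈ F | τ.Accessible N q r ε X Y}.ncard ≤ 1 := by
  refine (ncard_accessible_le hq hL hε hτ hm hX hFr hF (β := Unit) (fun _ _ => ()) ?_).trans_eq
    (by simp)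
  intro p p' P P' hP hP' _ i
  refine (wasserstein_le_diam hq hr (append_mem_probOnBall hm hP (hX i))
    (append_mem_probOnBall hm hP' (hX i))).trans (ENNReal.ofReal_le_ofReal ?_)
  rw [le_div_iff₀ hL]
  rw [mul_div_assoc', div_le_one hε] at hLr
  linarith

/-- The number of accessible outputs, in terms of a number `n` of cells of diameter `ε / (2L)`. -/
theorem exists_ncard_accessible_le (hN : ∀ x, N x = 0 → x = 0) {τ : Transformer d} (hq : 1 ≤ q)
    (hr : 0 < r) (hL : 0 < L) (hε : 0 < ε)
    (hτ : τ.MeanFieldLipschitz N q r L) (hm : 0 < m) {X : Fin k → Fin m → Fin d → ℝ}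
    (hX : ∀ i j, N (X i j) ≤ r) {F : Set (Fin k → Measure (Fin d → ℝ))} (hFr : F ⊆ outputs N r k)
    (hF : F.Pairwise (Distinct N q (3 * ε))) :
    ∃ n M : ℕ, 0 < n ∧ (n : ℝ) ≤ (1 + 8 * (L * r / ε)) ^ d ∧
      (M : ℝ) ≤ 2 * n * (2 * (L * r / ε)) ^ q + 1 ∧
      {Y ∈ F | τ.Accessible N q r ε X Y}.ncard ≤ (M + 1) ^ n := by
  have hc : 0 < ε / L := by positivity
  obtain ⟨n, C, hn, hle, hC⟩ := exists_isCellCover hN hr (half_pos hc)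
  have e : 2 * r / (ε / L) = 2 * (L * r / ε) := by field_simp
  set M := ⌈2 * (n : ℝ) * (2 * r / (ε / L)) ^ q⌉₊ with hMdef
  have hM : 2 * (n : ℝ) * (2 * r / (ε / L)) ^ q ≤ M := Nat.le_ceil _
  have hM0 : 0 < M := Nat.ceil_pos.2 (by positivity)
  have hM' : (0 : ℝ) < M := by exact_mod_cast hM0
  refine ⟨n, M, hn, ?_, ?_, ?_⟩
  · refine hle.trans_eq ?_
    congr 2
    field_simp
    norm_num
  · rw [← e]
    exact (Nat.ceil_lt_add_one (by positivity)).le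
  · refine (ncard_accessible_le hq hL hε hτ hm hX hFr hF (β := Fin n → Fin (M + 1))
      (fun p P j => ⟨⌊M * promptMass m P (C j)⌋₊, Nat.lt_succ_of_le (Nat.floor_le_of_le
        (mul_le_of_le_one_right hM'.le (promptMass_le_one _ _)))⟩) ?_).trans_eq (by simp)
    intro p p' P P' hP hP' hPP i
    refine hC.wasserstein_append_le hq hr.le (by positivity) hc.le hM0
      (cost_budget hq hr hc hM0 hM) hm (hX i) hP hP' fun j => ?_
    simpa using congrFun hPP j

end Discretization

/-! ### Explicit constants -/

section Constants

variable {d k : ℕ} {q L r ε C : ℝ}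

/-- `log (e (1 + (4Lr/ε)^q))^((6Lr/ε)^d)`. -/
noncomputable def logNumerator (d : ℕ) (q L r ε : ℝ) : ℝ :=
  (6 * L * r / ε) ^ d * (1 + Real.log (1 + (4 * L * r / ε) ^ q))

theorem logNumerator_nonneg (hL : 0 < L) (hr : 0 < r) (hε : 0 < ε) :
    0 ≤ logNumerator d q L r ε := by
  have h : 0 ≤ Real.log (1 + (4 * L * r / ε) ^ q) :=
    Real.log_nonneg (le_add_of_nonneg_right (by positivity))
  unfold logNumerator
  positivity

theorem memoryBound_eq (hL : 0 < L) (hr : 0 < r) (hε : 0 < ε) (hC : 0 < C) :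
    memoryBound d q L r ε C k =
      Real.exp (logNumerator d q L r ε - k * (3 ^ d / ε ^ d - Real.log C)) := by
  have h₁ : Real.exp 1 * (1 + (4 * L * r / ε) ^ q) =
      Real.exp (1 + Real.log (1 + (4 * L * r / ε) ^ q)) := by
    rw [Real.exp_add, Real.exp_log (by positivity)]
  have h₂ : 1 / C * Real.exp (3 ^ d / ε ^ d) = Real.exp (3 ^ d / ε ^ d - Real.log C) := by
    rw [Real.exp_sub, Real.exp_log hC]
    ring
  rw [memoryBound, h₁, h₂, ← Real.exp_mul, ← Real.exp_nat_mul, ← Real.exp_sub, logNumerator,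
    mul_comm (1 + _)]

theorem memoryThreshold_eq : memoryThreshold d q L r ε C =
    logNumerator d q L r ε / (3 ^ d / ε ^ d - Real.log C) := by
  rw [memoryThreshold, logNumerator, div_pow 3 ε d]

/-- With `u = L r / ε ≥ 1/2` and `Q = 1 + (4u)^q`, one has `n ≤ (10u)^d ≤ 2^d (6u)^d` and, as `10u ≤
e Q`, also `M + 1 ≤ (e Q)^(d + 2)`. This produces the factor `2^d (d + 2)`. -/
theorem pow_le_exp_logNumerator {n M : ℕ} (hq : 1 ≤ q) (hL : 0 < L) (hr : 0 < r) (hε : 0 < ε)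
    (hLr : 1 ≤ 2 * (L * r / ε)) (hn : 0 < n) (hnle : (n : ℝ) ≤ (1 + 8 * (L * r / ε)) ^ d)
    (hM : (M : ℝ) ≤ 2 * n * (2 * (L * r / ε)) ^ q + 1) :
    ((M : ℝ) + 1) ^ n ≤ Real.exp (2 ^ d * (d + 2) * logNumerator d q L r ε) := by
  have e₁ : 6 * L * r / ε = 6 * (L * r / ε) := by ring
  have e₂ : 4 * L * r / ε = 4 * (L * r / ε) := by ring
  rw [logNumerator, e₁, e₂]
  set u := L * r / ε with hu
  have hu0 : 0 < u := by positivity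
  set Q := 1 + (4 * u) ^ q with hQ
  have hQ1 : 1 ≤ Q := le_add_of_nonneg_right (by positivity)
  have h4u : 4 * u ≤ (4 * u) ^ q := Real.self_le_rpow_of_one_le (by linarith) hq
  have he : (2.7 : ℝ) < Real.exp 1 := by linarith [Real.exp_one_gt_d9]
  have hexp : Real.exp 1 * Q = Real.exp (1 + Real.log Q) := by
    rw [Real.exp_add, Real.exp_log (by linarith)]
  have h10 : 10 * u ≤ Real.exp 1 * Q := by nlinarith
  have hn10 : (n : ℝ) ≤ (10 * u) ^ d :=
    hnle.trans (pow_le_pow_left₀ (by positivity) (by linarith) d)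
  have h2u : 1 ≤ (2 * u) ^ q := Real.one_le_rpow hLr (by linarith)
  have h24 : (2 * u) ^ q ≤ (4 * u) ^ q :=
    Real.rpow_le_rpow (by positivity) (by linarith) (by linarith)
  have hn1 : (1 : ℝ) ≤ n := by exact_mod_cast hn
  have hM1 : (M : ℝ) + 1 ≤ (Real.exp 1 * Q) ^ (d + 2) := by
    calc (M : ℝ) + 1 ≤ 2 * n * (2 * u) ^ q + 2 := by linarith
      _ ≤ n * (4 * (2 * u) ^ q) := by nlinarith
      _ ≤ (Real.exp 1 * Q) ^ d * (Real.exp 1 * Q) ^ 2 := by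
        refine mul_le_mul (hn10.trans (pow_le_pow_left₀ (by positivity) h10 d)) ?_ (by positivity)
          (by positivity)
        nlinarith [mul_le_mul he.le he.le (by norm_num) (by positivity)]
      _ = _ := (pow_add _ _ _).symm
  calc ((M : ℝ) + 1) ^ n ≤ ((Real.exp 1 * Q) ^ (d + 2)) ^ n :=
        pow_le_pow_left₀ (by positivity) hM1 n
    _ = Real.exp (n * ((d + 2) * (1 + Real.log Q))) := by
        rw [hexp, ← Real.exp_nat_mul, ← Real.exp_nat_mul]
        push_cast
        rfl
    _ ≤ _ := by
        refine Real.exp_le_exp.2 ?_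
        have hl : 0 ≤ Real.log Q := Real.log_nonneg hQ1
        have hn12 : (n : ℝ) ≤ 2 ^ d * (6 * u) ^ d := by
          rw [← mul_pow]
          exact hn10.trans (pow_le_pow_left₀ (by positivity) (by linarith) d)
        calc (n : ℝ) * ((d + 2) * (1 + Real.log Q))
            ≤ (2 ^ d * (6 * u) ^ d) * ((d + 2) * (1 + Real.log Q)) := by gcongr
          _ = _ := by ring

/-- `log (4/3) ≥ 1/4`, and the floor loses at most `1`, which the term `-c` absorbs. -/
theorem exp_le_pow_floor {X c D : ℝ} (hc : 1 ≤ c) (hD : c * D ≤ X / 8 - c) :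
    Real.exp (k * (c * D)) ≤ (4 / 3 : ℝ) ^ (⌊X / 2⌋₊ * k) := by
  have hlog : (1 / 4 : ℝ) ≤ Real.log (4 / 3) := by
    have := Real.one_sub_inv_le_log_of_pos (show (0 : ℝ) < 4 / 3 by norm_num)
    norm_num at this ⊢
    exact this
  have hfl := Nat.lt_floor_add_one (X / 2)
  have h : c * D ≤ ⌊X / 2⌋₊ * Real.log (4 / 3) := by
    have h₀ : (0 : ℝ) ≤ ⌊X / 2⌋₊ := Nat.cast_nonneg _
    nlinarith
  calc Real.exp (k * (c * D)) ≤ Real.exp (k * (⌊X / 2⌋₊ * Real.log (4 / 3))) := by gcongr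
    _ = (4 / 3 : ℝ) ^ (⌊X / 2⌋₊ * k) := by
      rw [pow_mul, Real.exp_nat_mul, Real.exp_nat_mul, Real.exp_log (by norm_num)]

/-- The rate `(3r/(ρε))^d - 1`, for `ρ = 1152 c`, is dominated by the packing number of the
ball. -/
theorem rate_le (hd : 1 ≤ d) {c : ℝ} (hc : 1 ≤ c) (hr : 0 < r) (hε : 0 < ε) :
    c * ((3 * r / (1152 * c)) ^ d / ε ^ d - 1) ≤ (r / (16 * (3 * ε))) ^ d / 8 - c := by
  -- `1152 = 3 * 48 * 8`: `48` from the separation `16 * (3ε)`, `8` from the rate `X / 8`.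
  have e : (3 * r / (1152 * c)) ^ d / ε ^ d = (r / (16 * (3 * ε))) ^ d / (8 * c) ^ d := by
    rw [← div_pow, ← div_pow]
    congr 1
    field_simp
    norm_num
  have h : 8 * c ≤ (8 * c) ^ d := le_self_pow₀ (by linarith) (by omega)
  have h' : (r / (16 * (3 * ε))) ^ d / (8 * c) ^ d ≤ (r / (16 * (3 * ε))) ^ d / (8 * c) := by
    gcongr
  rw [e]
  calc _ ≤ c * ((r / (16 * (3 * ε))) ^ d / (8 * c) - 1) := by gcongr
    _ = _ := by field_simp

end Constants

/-! ### The main theorem -/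

theorem accessibleProportion_le_one {d k m : ℕ} (τ : Transformer d) (N : Seminorm ℝ (Fin d → ℝ))
    (q r ε : ℝ) (X : Fin k → Fin m → Fin d → ℝ) {F : Set (Fin k → Measure (Fin d → ℝ))}
    (hF : F.Finite) : τ.accessibleProportion N q r ε X F ≤ 1 :=
  div_le_one_of_le₀ (Nat.cast_le.2 (Set.ncard_le_ncard (Set.sep_subset _ _) hF))
    (Nat.cast_nonneg _)

theorem ncard_accessible_le_exp {d k m : ℕ} {N : Seminorm ℝ (Fin d → ℝ)} {q r L ε : ℝ}
    (hN : ∀ x, N x = 0 → x = 0) {τ : Transformer d} (hq : 1 ≤ q)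
    (hr : 0 < r) (hL : 0 < L) (hε : 0 < ε)
    (hτ : τ.MeanFieldLipschitz N q r L) (hm : 0 < m) {X : Fin k → Fin m → Fin d → ℝ}
    (hX : ∀ i j, N (X i j) ≤ r) {F : Set (Fin k → Measure (Fin d → ℝ))} (hFr : F ⊆ outputs N r k)
    (hF : F.Pairwise (Distinct N q (3 * ε))) :
    ({Y ∈ F | τ.Accessible N q r ε X Y}.ncard : ℝ) ≤
      Real.exp (2 ^ d * (d + 2) * logNumerator d q L r ε) := by
  rcases le_total (2 * (L * r / ε)) 1 with h | h
  · have h₁ := ncard_accessible_le_one hq hr hL hε h hτ hm hX hFr hF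
    refine le_trans (by exact_mod_cast h₁) (Real.one_le_exp ?_)
    have := logNumerator_nonneg (d := d) (q := q) hL hr hε
    positivity
  · obtain ⟨n, M, hn, hnle, hM, hcard⟩ := exists_ncard_accessible_le hN hq hr hL hε hτ hm hX hFr hF
    refine le_trans ?_ (pow_le_exp_logNumerator hq hL hr hε h hn hnle hM)
    exact_mod_cast hcard

theorem mainTheorem2 (d : ℕ) (hd : 1 ≤ d) (q : ℝ) (hq : 1 ≤ q) :
    ∃ (ρ C₀ : ℝ) (C : ℝ → ℝ → ℝ), 0 < ρ ∧ 0 < C₀ ∧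
      (∀ r ε : ℝ, 0 < r → 0 < ε →
        0 < C r ε ∧ C r ε ≤ C₀ * Real.exp ((3 ^ d - (3 * r / ρ) ^ d) / ε ^ d)) ∧
      ∀ (N : Seminorm ℝ (Fin d → ℝ)), (∀ x, N x = 0 → x = 0) →
      ∀ (τ : Transformer d) (L r ε : ℝ), 0 < L → 0 < r → 0 < ε →
        τ.MeanFieldLipschitz N q r L →
        (∀ k : ℕ, memoryThreshold d q L r ε (C r ε) < k →
          (∀ (m : ℕ), 0 < m →
            ∀ X : Fin k → Fin m → Fin d → ℝ, (∀ i j, N (X i j) ≤ r) →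
            ∀ F : Set (Fin k → Measure (Fin d → ℝ)), IsMaximalDistinct N q r (3 * ε) F →
              F.Finite ∧ F.Nonempty ∧
              τ.accessibleProportion N q r ε X F ≤ memoryBound d q L r ε (C r ε) k) ∧
          (Real.log (C r ε) < (3 / ε) ^ d → memoryBound d q L r ε (C r ε) k < 1)) ∧
        (fun k : ℕ => memoryBound d q L r ε (C r ε) k) =O[atTop]
          (fun k : ℕ => Real.exp (-(k : ℝ) * (3 ^ d / ε ^ d - Real.log (C r ε)))) ∧
        (C r ε ≤ 1 → (fun k : ℕ => memoryBound d q L r ε (C r ε) k) =O[atTop]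
          (fun k : ℕ => Real.exp (-(k : ℝ) * (3 ^ d / ε ^ d)))) := by
  set c : ℝ := 2 ^ d * (d + 2) with hc
  have hc1 : 1 ≤ c := by
    have h₁ : (1 : ℝ) ≤ 2 ^ d := one_le_pow₀ (by norm_num)
    nlinarith [(Nat.cast_nonneg d : (0 : ℝ) ≤ d)]
  -- The bound on `C` is taken as an equality. The factor `e` makes `D = (3r/(ρε))^d - 1`, and this
  -- `-1` pays for the floor in the packing number.
  refine ⟨1152 * c, Real.exp 1, fun r ε => Real.exp 1 *
    Real.exp ((3 ^ d - (3 * r / (1152 * c)) ^ d) / ε ^ d), by positivity, by positivity,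
    fun r ε _ _ => ⟨by positivity, le_rfl⟩, ?_⟩
  intro N hN τ L r ε hL hr hε hτ
  beta_reduce
  set C : ℝ := Real.exp 1 * Real.exp ((3 ^ d - (3 * r / (1152 * c)) ^ d) / ε ^ d) with hC
  have hC0 : 0 < C := by positivity
  set A := logNumerator d q L r ε with hA
  have hA0 : 0 ≤ A := logNumerator_nonneg hL hr hε
  set D := 3 ^ d / ε ^ d - Real.log C with hD
  have hD' : D = (3 * r / (1152 * c)) ^ d / ε ^ d - 1 := by
    rw [hD, hC, ← Real.exp_add, Real.log_exp]
    ring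
  have hbound : ∀ k : ℕ, memoryBound d q L r ε C k = Real.exp (A - k * D) := fun k =>
    memoryBound_eq hL hr hε hC0
  have hneg : ∀ k : ℕ, memoryThreshold d q L r ε C < k → 0 < D → A - k * D < 0 := by
    intro k hk hD0
    rw [memoryThreshold_eq, div_lt_iff₀ hD0] at hk
    linarith
  have hO : (fun k : ℕ => memoryBound d q L r ε C k) =O[atTop]
      (fun k : ℕ => Real.exp (-(k : ℝ) * D)) := by
    refine IsBigO.of_bound (Real.exp A) (Eventually.of_forall fun k => ?_)
    rw [hbound, Real.norm_of_nonneg (Real.exp_pos _).le, Real.norm_of_nonneg (Real.exp_pos _).le,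
      ← Real.exp_add]
    exact Real.exp_le_exp.2 (by linarith)
  refine ⟨fun k hk => ⟨fun m hm X hX F hF => ?_, fun hlog => ?_⟩, hO, fun hC1 => hO.trans ?_⟩
  · have hfin := hF.finite hN hq hr (by positivity)
    have hne := hF.nonempty hq hr
    refine ⟨hfin, hne, ?_⟩
    rw [hbound]
    rcases le_or_gt D 0 with hD0 | hD0
    · refine (accessibleProportion_le_one τ N q r ε X hfin).trans (Real.one_le_exp ?_)
      have : (k : ℝ) * D ≤ 0 := mul_nonpos_of_nonneg_of_nonpos (Nat.cast_nonneg k) hD0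
      linarith
    · have hrate := rate_le hd hc1 hr hε
      rw [← hD'] at hrate
      set Y := (r / (16 * (3 * ε))) ^ d with hY
      -- `D > 0` forces `Y > 8c`, so at least one pair of separated points is available.
      have hY8 : 8 ≤ Y := by nlinarith
      have hn : 0 < ⌊Y / 2⌋₊ := Nat.floor_pos.2 (by linarith)
      have hcard : Real.exp (k * (c * D)) ≤ F.ncard :=
        (exp_le_pow_floor hc1 hrate).trans
          (hF.pow_le_ncard hN hq hr (by positivity) hfin hn
            (by linarith [Nat.floor_le (show 0 ≤ Y / 2 by positivity)]))
      have hacc := ncard_accessible_le_exp hN hq hr hL hε hτ hm hX hF.1.1 hF.1.2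
      calc τ.accessibleProportion N q r ε X F
          ≤ Real.exp (c * A) / Real.exp (k * (c * D)) :=
            div_le_div₀ (Real.exp_pos _).le hacc (Real.exp_pos _) hcard
        _ = Real.exp (c * (A - k * D)) := by rw [← Real.exp_sub]; congr 1; ring
        -- `A - k D` is negative and `c ≥ 1`.
        _ ≤ Real.exp (A - k * D) := by
            refine Real.exp_le_exp.2 ?_
            nlinarith [hneg k hk hD0]
  · rw [div_pow] at hlog
    rw [hbound, Real.exp_lt_one_iff]
    exact hneg k hk (by linarith)
  · refine IsBigO.of_bound 1 (Eventually.of_forall fun k => ?_)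
    rw [Real.norm_of_nonneg (Real.exp_pos _).le, Real.norm_of_nonneg (Real.exp_pos _).le, one_mul]
    refine Real.exp_le_exp.2 ?_
    have h₁ : (k : ℝ) * Real.log C ≤ 0 :=
      mul_nonpos_of_nonneg_of_nonpos (Nat.cast_nonneg k) (Real.log_nonpos hC0.le hC1)
    rw [hD]
    linarith
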